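/- Let $l\ge-\frac12$ be real, let $q:(0,1)\to\mathbb R$ be measurable, set $\tilde q(x)=|q(x)|$ if $l>-\frac12$ and $\tilde q(x)=(1-\log x)\,|q(x)|$ if $l=-\frac12$, and assume $x\,\tilde q(x)\in L^1(0,1)$. Consider on $(0,1)$ the differential expression $$Hf=-f''+\frac{l(l+1)}{x^2}f+q f .$$ A solution of $Hf=zf$ is a differentiable function $f:(0,1)\to\mathbb C$ whose derivative is absolutely continuous on every compact subinterval of $(0,1)$ and which satisfies the equation almost everywhere; $W(f,g)=fg'-f'g$ denotes the Wronskian. Then for every $z\in\mathbb C$ the equation $Hf=zf$ has two linearly independent solutions $\phi(z,\cdot)$, $\theta(z,\cdot)$ with $W(\theta(z),\phi(z))=1$ on $(0,1)$, of the form $$\phi(z,x)=x^{l+1}\tilde\phi(z,x),\qquad \theta(z,x)=\begin{cases}\dfrac{x^{-l}}{2l+1}\,\tilde\theta(z,x), & l>-\frac12,\\[2mm] -x^{1/2}\log(x)\,\tilde\theta(z,x), & l=-\frac12,\end{cases}\qquad z\in\mathbb C,\ 0<x<1,$$ where $\tilde\phi$ is jointly continuous on $\mathbb C\times[0,1]$;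 $\tilde\theta$ is jointly continuous on $\mathbb C\times[0,1]$ if $l>-\frac12$; and, if $l=-\frac12$, $\tilde\theta$ is jointly continuous on $\mathbb C\times[0,1)$ while $\theta$ itself extends to a jointly continuous function on $\mathbb C\times(0,1]$. Moreover, for all $z\in\mathbb C$, $$\tilde\phi(z,0)=\tilde\theta(z,0)^{-1}\neq0 .$$ -/

import Mathlib

open Set MeasureTheory

noncomputable section

namespace SphericalSchrodinger

/-- The weighted modulus `q̃` of the potential: `|q|` for `l > -1/2` and `(1 - log x) |q|` for
`l = -1/2`. -/
def qTilde (l : ℝ) (q : ℝ → ℝ) (x : ℝ) : ℝ :=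
  if l = -1 / 2 then (1 - Real.log x) * |q x| else |q x|

/-- The standing assumption on the angular momentum `l` and on the (measurable) real-valued
potential `q` on `(0, 1)`: `l ≥ -1/2` and `x q̃(x) ∈ L¹(0, 1)`. -/
structure IsAdmissible (l : ℝ) (q : ℝ → ℝ) : Prop where
  neg_half_le : -1 / 2 ≤ l
  measurable : AEStronglyMeasurable q (volume.restrict (Ioo 0 1))
  integrable : IntegrableOn (fun x => x * qTilde l q x) (Ioo 0 1)

/-- The differential expression `H f = -f'' + l (l + 1) / x² f + q f`. -/
def H (l : ℝ) (q : ℝ → ℝ) (f : ℝ → ℂ) (x : ℝ) : ℂ :=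
  -deriv (deriv f) x + ((l * (l + 1) / x ^ 2 : ℝ) : ℂ) * f x + (q x : ℂ) * f x

/-- `f` solves `H f = z f` on `(0, 1)` in the Carathéodory sense: `f` is differentiable, `f'` is
absolutely continuous on every compact subinterval of `(0, 1)` (so `f''` exists almost everywhere),
and the equation holds almost everywhere. -/
structure IsSolution (l : ℝ) (q : ℝ → ℝ) (z : ℂ) (f : ℝ → ℂ) : Prop where
  differentiableAt : ∀ x ∈ Ioo (0 : ℝ) 1, DifferentiableAt ℝ f x
  deriv_absolutelyContinuous : ∀ a b : ℝ, 0 < a → a ≤ b → b < 1 →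
    AbsolutelyContinuousOnInterval (deriv f) a b
  equation : ∀ᵐ x ∂(volume.restrict (Ioo (0 : ℝ) 1)), H l q f x = z * f x

/-- The Wronskian `W(f, g) = f g' - f' g`. -/
def W (f g : ℝ → ℂ) (x : ℝ) : ℂ :=
  f x * deriv g x - deriv f x * g x

end SphericalSchrodinger

end

/-! Writing `f = x^(l+1) u` turns `H f = z f` into `(p u')' = p (q - z) u` with `p = x^(2l+2)`. With
`p` alone this equation has the solutions `1` and `1/γ`, where `γ = (2l+1) x^(2l+1)` if `l > -1/2`
and `γ = 1/(1 - log x)` if `l = -1/2`. Working with `1 - log x` instead of `-log x` keeps `γ`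
positive up to `x = 1`.

Variation of parameters gives two Volterra equations: one from `0` for the regular solution `u`, one
from `1` for `v`, where `v/γ` is a singular solution. Monotonicity of `γ` bounds both kernels by
`1`, and what remains is the weight `(p/γ)(q - z)`. Since `p/γ` is `x/(2l+1)` or `x(1 - log x)`, the
hypothesis on `q` says exactly that this weight is integrable. The Volterra operators are
quasinilpotent and affine in `z`, so `exists_volterra_resolvent` solves the equations in `C([0,1])`
continuously in `z`, which is joint continuity up to the endpoints.

The modified Wronskian of `v/γ` and `u` is constant, and its limit at `0` is `v(0)`. Two independent
solutions `v₁/γ`, `v₂/γ` cannot both have `vᵢ(0) = 0`, since `u` would then vanish identically. A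
continuous combination of them therefore has `v(0) = 1` (`exists_solution_pair`). This gives
Wronskian `1` and the value `1` at `0` for both reduced functions. -/

open Filter Topology

/-! ### Absolute continuity of vector-valued primitives -/

namespace AbsolutelyContinuousOnInterval

variable {E : Type*} [NormedAddCommGroup E]

theorem congr {f g : ℝ → E} {a b : ℝ} (hf : AbsolutelyContinuousOnInterval f a b)
    (h : EqOn f g (uIcc a b)) : AbsolutelyContinuousOnInterval g a b := by
  refine Tendsto.congr' ?_ hf
  filter_upwards [mem_inf_of_right (mem_principal_self _)] with P hP
  refine Finset.sum_congr rfl fun i hi => ?_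
  rw [h (hP.1 i hi).1, h (hP.1 i hi).2]

theorem of_dist_le {f : ℝ → E} {g : ℝ → ℝ} {a b : ℝ} (hg : AbsolutelyContinuousOnInterval g a b)
    (h : ∀ x ∈ uIcc a b, ∀ y ∈ uIcc a b, dist (f x) (f y) ≤ dist (g x) (g y)) :
    AbsolutelyContinuousOnInterval f a b := by
  refine squeeze_zero' (Eventually.of_forall fun P => Finset.sum_nonneg fun i _ => dist_nonneg)
    ?_ hg
  filter_upwards [mem_inf_of_right (mem_principal_self _)] with P hP
  exact Finset.sum_le_sum fun i hi => h _ (hP.1 i hi).1 _ (hP.1 i hi).2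

theorem const (c : E) (a b : ℝ) : AbsolutelyContinuousOnInterval (fun _ => c) a b := by
  simpa [AbsolutelyContinuousOnInterval] using tendsto_const_nhds

end AbsolutelyContinuousOnInterval

/-- Increments of the primitive of `f` are dominated by those of the real primitive of `‖f‖`. -/
theorem IntervalIntegrable.absolutelyContinuousOnInterval_integral {E : Type*}
    [NormedAddCommGroup E] [NormedSpace ℝ E] {f : ℝ → E} {a b c : ℝ}
    (h : IntervalIntegrable f volume a b) (hc : c ∈ uIcc a b) :
    AbsolutelyContinuousOnInterval (fun x => ∫ v in c..x, f v) a b := by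
  refine (h.norm.absolutelyContinuousOnInterval_intervalIntegral hc).of_dist_le
    fun x hx y hy => ?_
  have hi : ∀ t ∈ uIcc a b, IntervalIntegrable f volume c t := fun t ht =>
    h.mono_set (uIcc_subset_uIcc hc ht)
  rw [dist_eq_norm, dist_eq_norm,
    intervalIntegral.integral_interval_sub_left (hi x hx) (hi y hy),
    intervalIntegral.integral_interval_sub_left (hi x hx).norm (hi y hy).norm, Real.norm_eq_abs]
  exact intervalIntegral.norm_integral_le_abs_integral_norm

/-! ### Volterra operators on `C([0, 1])` -/

/-- `∫ m Fⁿ = Fⁿ⁺¹ / (n + 1)` for the primitive `F` of an integrable function `m`. -/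
theorem intervalIntegral.integral_mul_primitive_pow {m : ℝ → ℝ} {a b : ℝ}
    (hm : IntervalIntegrable m volume a b) (n : ℕ) :
    ∫ y in a..b, m y * (∫ t in a..y, m t) ^ n = (∫ t in a..b, m t) ^ (n + 1) / (n + 1) := by
  set F : ℝ → ℝ := fun x => ∫ t in a..x, m t with hF
  have hac : AbsolutelyContinuousOnInterval F a b :=
    hm.absolutelyContinuousOnInterval_integral left_mem_uIcc
  have hpow : ∀ k : ℕ, AbsolutelyContinuousOnInterval (fun x => F x ^ k) a b := by
    intro k
    induction k with
    | zero => simpa using AbsolutelyContinuousOnInterval.const (1 : ℝ) a b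
    | succ k ih => simpa [pow_succ] using ih.fun_mul hac
  -- As `m` is merely integrable, `F` is differentiable only almost everywhere; absolute continuity
  -- of `Fⁿ⁺¹` is what permits the fundamental theorem.
  have h := (hpow (n + 1)).integral_deriv_eq_sub
  have h0 : F a = 0 := by simp [hF]
  rw [h0, zero_pow n.succ_ne_zero, sub_zero] at h
  rw [eq_div_iff (by positivity), ← h, mul_comm, ← intervalIntegral.integral_const_mul]
  refine intervalIntegral.integral_congr_ae ?_
  filter_upwards [hm.ae_hasDerivAt_integral] with y hy hyab
  have := (hy (uIoc_subset_uIcc hyab) a left_mem_uIcc).pow (n + 1)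
  rw [show deriv (fun x => F x ^ (n + 1)) y = _ from this.deriv]
  push_cast
  ring

/-- `|∫ m |F|ⁿ| = |F|ⁿ⁺¹ / (n + 1)` for the primitive `F` of a nonnegative function `m`. -/
theorem intervalIntegral.abs_integral_mul_abs_primitive_pow {m : ℝ → ℝ} {a b : ℝ}
    (hm : IntervalIntegrable m volume a b) (hm0 : ∀ y, 0 ≤ m y) (n : ℕ) :
    |∫ y in a..b, m y * |∫ t in a..y, m t| ^ n| = |∫ t in a..b, m t| ^ (n + 1) / (n + 1) := by
  -- The primitive has one sign on the whole interval, so the absolute values reduce to a factor `s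
  -- = ±1`. The case `b ≤ a` serves the equation that starts from `1`.
  have key : ∃ s : ℝ, |s| = 1 ∧ ∀ y ∈ uIcc a b,
      |∫ t in a..y, m t| = s * ∫ t in a..y, m t := by
    rcases le_total a b with hab | hab
    · refine ⟨1, by simp, fun y hy => ?_⟩
      rw [uIcc_of_le hab] at hy
      rw [one_mul, abs_of_nonneg (intervalIntegral.integral_nonneg hy.1 fun t _ => hm0 t)]
    · refine ⟨-1, by simp, fun y hy => ?_⟩
      rw [uIcc_of_ge hab] at hy
      rw [intervalIntegral.integral_symm, abs_neg, abs_of_nonneg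
        (intervalIntegral.integral_nonneg hy.2 fun t _ => hm0 t)]
      ring
  obtain ⟨s, hs, hF⟩ := key
  have : ∫ y in a..b, m y * |∫ t in a..y, m t| ^ n
      = s ^ n * ∫ y in a..b, m y * (∫ t in a..y, m t) ^ n := by
    rw [← intervalIntegral.integral_const_mul]
    refine intervalIntegral.integral_congr fun y hy => ?_
    simp only [hF y hy]
    ring
  rw [this, integral_mul_primitive_pow hm, abs_mul, abs_pow, hs, one_pow, one_mul, abs_div,
    abs_pow, abs_of_nonneg (show (0 : ℝ) ≤ n + 1 by positivity)]

/-- `1 - t` is a factor of `1 - tⁿ`, and it commutes with the cofactor, a geometric sum. -/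
theorem IsUnit.one_sub_of_one_sub_pow {R : Type*} [Ring R] {t : R} {n : ℕ}
    (h : IsUnit (1 - t ^ n)) : IsUnit (1 - t) := by
  rw [← mul_neg_geom_sum t n] at h
  have hc : Commute (1 - t) (∑ i ∈ Finset.range n, t ^ i) :=
    (Commute.one_left _).sub_left
      (Commute.sum_right _ _ _ fun i _ => Commute.pow_right (Commute.refl t) i)
  exact (hc.isUnit_mul_iff.1 h).1

theorem continuous_ringInverse_pencil {A : Type*} [NormedRing A] [NormedAlgebra ℂ A]
    [HasSummableGeomSeries A] (a b : A) (hu : ∀ z : ℂ, IsUnit (1 - (a - z • b))) :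
    Continuous fun z : ℂ => Ring.inverse (1 - (a - z • b)) := by
  refine continuous_iff_continuousAt.2 fun z => ?_
  obtain ⟨u, hu⟩ := hu z
  have h : ContinuousAt Ring.inverse (1 - (a - z • b)) := hu ▸ NormedRing.inverse_continuousAt u
  have hf : Continuous fun z : ℂ => 1 - (a - z • b) := by fun_prop
  exact h.comp (f := fun z : ℂ => 1 - (a - z • b)) hf.continuousAt

/-- An operator on `C([0, 1])` dominated by a Volterra operator with integrable weight is
quasinilpotent. -/
theorem isUnit_one_sub_of_volterra_bound (T : C(Icc (0 : ℝ) 1, ℂ) →L[ℂ] C(Icc (0 : ℝ) 1, ℂ))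
    {m : ℝ → ℝ} (hm : IntervalIntegrable m volume 0 1) (hm0 : ∀ y, 0 ≤ m y)
    {c : ℝ} (hc : c ∈ Icc (0 : ℝ) 1)
    (hT : ∀ f (x : Icc (0 : ℝ) 1),
      ‖T f x‖ ≤ |∫ y in c..x, m y * ‖IccExtend zero_le_one f y‖|) :
    IsUnit (1 - T) := by
  have h01 : uIcc (0 : ℝ) 1 = Icc 0 1 := uIcc_of_le zero_le_one
  have hmc : ∀ x ∈ Icc (0 : ℝ) 1, IntervalIntegrable m volume c x := fun x hx =>
    hm.mono_set (uIcc_subset_uIcc (h01 ▸ hc) (h01 ▸ hx))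
  -- The usual Volterra iteration: each application of `T` integrates the previous power of the
  -- primitive of `m` against `m` and so supplies the next factor of `n!`.
  have bound : ∀ (n : ℕ) f (x : Icc (0 : ℝ) 1),
      ‖(T ^ n) f x‖ ≤ |∫ t in c..x, m t| ^ n / n.factorial * ‖f‖ := by
    intro n
    induction n with
    | zero => intro f x; simpa using f.norm_coe_le_norm x
    | succ n ih =>
      intro f x
      rw [pow_succ']
      refine (hT _ x).trans ?_
      have hsub : uIcc c (x : ℝ) ⊆ Icc 0 1 := uIcc_subset_Icc hc x.2
      have hF : ContinuousOn (fun y => |∫ t in c..y, m t| ^ n) (uIcc c x) :=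
        ((hmc x x.2).absolutelyContinuousOnInterval_integral left_mem_uIcc).continuousOn.abs.pow n
      have h1 : |∫ y in c..x, m y * ‖IccExtend zero_le_one ((T ^ n) f) y‖| ≤
          |∫ y in c..x, m y * |∫ t in c..y, m t| ^ n * (‖f‖ / n.factorial)| := by
        rw [← Real.norm_eq_abs]
        refine intervalIntegral.norm_integral_le_abs_of_norm_le ?_
          (((hmc x x.2).mul_continuousOn hF).mul_const _)
        filter_upwards [ae_restrict_mem measurableSet_uIoc] with y hy
        have hy' : y ∈ Icc (0 : ℝ) 1 := hsub (uIoc_subset_uIcc hy)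
        rw [IccExtend_of_mem _ _ hy', norm_mul, norm_norm, Real.norm_of_nonneg (hm0 y), mul_assoc,
          mul_div_assoc', ← div_mul_eq_mul_div]
        exact mul_le_mul_of_nonneg_left (ih f ⟨y, hy'⟩) (hm0 y)
      refine h1.trans (le_of_eq ?_)
      rw [intervalIntegral.integral_mul_const, abs_mul,
        intervalIntegral.abs_integral_mul_abs_primitive_pow (hmc x x.2) hm0,
        abs_of_nonneg (by positivity : 0 ≤ ‖f‖ / (n.factorial : ℝ)), Nat.factorial_succ]
      push_cast
      field_simp
  set M := ∫ t in (0 : ℝ)..1, m t with hM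
  have hMx : ∀ x ∈ Icc (0 : ℝ) 1, |∫ t in c..x, m t| ≤ M := by
    intro x hx
    have := intervalIntegral.abs_integral_mono_interval (f := m) (μ := volume)
      (a := c) (b := x) (c := 0) (d := 1) ?_ (Eventually.of_forall hm0) hm
    · refine this.trans (le_of_eq (abs_of_nonneg ?_))
      exact intervalIntegral.integral_nonneg zero_le_one fun t _ => hm0 t
    · rw [uIoc_of_le zero_le_one]
      exact fun y hy => ⟨(le_min hc.1 hx.1).trans_lt hy.1, hy.2.trans (max_le hc.2 hx.2)⟩
  have hM0 : 0 ≤ M := intervalIntegral.integral_nonneg zero_le_one fun t _ => hm0 t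
  have hnorm : ∀ n : ℕ, ‖T ^ n‖ ≤ M ^ n / n.factorial := by
    intro n
    refine ContinuousLinearMap.opNorm_le_bound _ (by positivity) fun f => ?_
    rw [ContinuousMap.norm_le _ (by positivity)]
    intro x
    refine (bound n f x).trans ?_
    gcongr
    exact hMx x x.2
  -- A single power of norm less than `1` suffices; the full Neumann series of `T` is not summed.
  obtain ⟨n, hn⟩ := ((FloorSemiring.tendsto_pow_div_factorial_atTop M).eventually
    (gt_mem_nhds zero_lt_one)).exists
  exact (Units.oneSub (T ^ n) ((hnorm n).trans_lt hn)).isUnit.one_sub_of_one_sub_pow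

/-- The integral operator on `C([0, 1])` with kernel `κ x y * w y`, where `κ` is bounded and
continuous and `w` is integrable. -/
theorem exists_kernel_operator {κ : Icc (0 : ℝ) 1 → ℝ → ℝ} {w : ℝ → ℂ}
    (hκ : ∀ x, ∀ y ∈ Ioc (0 : ℝ) 1, |κ x y| ≤ 1)
    (hκx : ∀ y ∈ Ioc (0 : ℝ) 1, Continuous fun x => κ x y)
    (hκy : ∀ x, ContinuousOn (κ x) (Ioc 0 1))
    (hw : IntervalIntegrable w volume 0 1) :
    ∃ T : C(Icc (0 : ℝ) 1, ℂ) →L[ℂ] C(Icc (0 : ℝ) 1, ℂ), ∀ (f : C(Icc (0 : ℝ) 1, ℂ)) x,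
      IntervalIntegrable (fun y => (κ x y : ℂ) * (w y * IccExtend zero_le_one f y)) volume 0 1 ∧
      T f x = ∫ y in (0 : ℝ)..1, (κ x y : ℂ) * (w y * IccExtend zero_le_one f y) := by
  have hI : uIoc (0 : ℝ) 1 = Ioc 0 1 := uIoc_of_le zero_le_one
  have hfn : ∀ (f : C(Icc (0 : ℝ) 1, ℂ)) y, ‖IccExtend zero_le_one f y‖ ≤ ‖f‖ := fun f y =>
    f.norm_coe_le_norm _
  have hmeas : ∀ (f : C(Icc (0 : ℝ) 1, ℂ)) x, AEStronglyMeasurable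
      (fun y => (κ x y : ℂ) * (w y * IccExtend zero_le_one f y)) (volume.restrict (uIoc 0 1)) := by
    intro f x
    have h1 : AEStronglyMeasurable (fun y => (κ x y : ℂ)) (volume.restrict (uIoc 0 1)) := by
      rw [hI]
      exact (Complex.continuous_ofReal.comp_continuousOn (hκy x)).aestronglyMeasurable
        measurableSet_Ioc
    refine h1.mul (AEStronglyMeasurable.mul ?_ ?_)
    · rw [hI]; exact hw.1.aestronglyMeasurable
    · exact (f.continuous.Icc_extend').aestronglyMeasurable
  have hbound : ∀ (f : C(Icc (0 : ℝ) 1, ℂ)) x, ∀ y ∈ uIoc (0 : ℝ) 1,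
      ‖(κ x y : ℂ) * (w y * IccExtend zero_le_one f y)‖ ≤ ‖w y‖ * ‖f‖ := by
    intro f x y hy
    rw [norm_mul, norm_mul, Complex.norm_real, Real.norm_eq_abs]
    refine (mul_le_of_le_one_left (by positivity) (hκ x y (hI ▸ hy))).trans ?_
    gcongr
    exact hfn f y
  have hint : ∀ (f : C(Icc (0 : ℝ) 1, ℂ)) x, IntervalIntegrable
      (fun y => (κ x y : ℂ) * (w y * IccExtend zero_le_one f y)) volume 0 1 := by
    intro f x
    refine (hw.norm.mul_const ‖f‖).mono_fun (hmeas f x) ?_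
    filter_upwards [ae_restrict_mem measurableSet_uIoc] with y hy
    exact (hbound f x y hy).trans (le_abs_self _)
  have hcont : ∀ f : C(Icc (0 : ℝ) 1, ℂ), Continuous fun x : Icc (0 : ℝ) 1 =>
      ∫ y in (0 : ℝ)..1, (κ x y : ℂ) * (w y * IccExtend zero_le_one f y) := by
    intro f
    refine intervalIntegral.continuous_of_dominated_interval (hmeas f)
      (fun x => Eventually.of_forall (hbound f x)) (hw.norm.mul_const ‖f‖)
      (Eventually.of_forall fun y hy => ?_)
    exact (Complex.continuous_ofReal.comp (hκx y (hI ▸ hy))).mul continuous_const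
  let T₀ : C(Icc (0 : ℝ) 1, ℂ) →ₗ[ℂ] C(Icc (0 : ℝ) 1, ℂ) :=
    { toFun := fun f => ⟨_, hcont f⟩
      map_add' := by
        intro f g
        ext x
        simp only [ContinuousMap.coe_mk, ContinuousMap.add_apply]
        rw [← intervalIntegral.integral_add (hint f x) (hint g x)]
        refine intervalIntegral.integral_congr fun y _ => ?_
        simp only [IccExtend_apply, ContinuousMap.add_apply]
        ring
      map_smul' := by
        intro c f
        ext x
        simp only [ContinuousMap.coe_mk, ContinuousMap.smul_apply, RingHom.id_apply, smul_eq_mul]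
        rw [← intervalIntegral.integral_const_mul]
        refine intervalIntegral.integral_congr fun y _ => ?_
        simp only [IccExtend_apply, ContinuousMap.smul_apply, smul_eq_mul]
        ring }
  refine ⟨T₀.mkContinuous (∫ y in (0 : ℝ)..1, ‖w y‖) fun f => ?_, fun f x => ⟨hint f x, rfl⟩⟩
  have hw0 : 0 ≤ ∫ y in (0 : ℝ)..1, ‖w y‖ :=
    intervalIntegral.integral_nonneg zero_le_one fun y _ => norm_nonneg _
  rw [ContinuousMap.norm_le _ (by positivity)]
  intro x
  rw [← intervalIntegral.integral_mul_const]
  refine intervalIntegral.norm_integral_le_of_norm_le zero_le_one ?_ (hw.norm.mul_const ‖f‖)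
  exact Eventually.of_forall fun y hy => hbound f x y (hI ▸ hy)

/-- Solution operator of the Volterra equation `f = h + ∫ κ (w₀ - z w₁) f` on `[0, 1]`: it depends
continuously on the parameter `z`. The integral extends over the points between `c` and `x`. -/
theorem exists_volterra_resolvent {κ : Icc (0 : ℝ) 1 → ℝ → ℝ} {w₀ w₁ : ℝ → ℂ} {c : ℝ}
    (hc : c ∈ Icc (0 : ℝ) 1)
    (hκ : ∀ x, ∀ y ∈ Ioc (0 : ℝ) 1, |κ x y| ≤ 1)
    (hκx : ∀ y ∈ Ioc (0 : ℝ) 1, Continuous fun x => κ x y)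
    (hκy : ∀ x, ContinuousOn (κ x) (Ioc 0 1))
    (hκc : ∀ x : Icc (0 : ℝ) 1, ∀ y ∈ Ioc (0 : ℝ) 1, y ∉ uIoc c x → κ x y = 0)
    (hw₀ : IntervalIntegrable w₀ volume 0 1) (hw₁ : IntervalIntegrable w₁ volume 0 1) :
    ∃ R : ℂ → C(Icc (0 : ℝ) 1, ℂ) →L[ℂ] C(Icc (0 : ℝ) 1, ℂ), Continuous R ∧ ∀ z h x,
      R z h x = h x + ∫ y in (0 : ℝ)..1,
        (κ x y : ℂ) * ((w₀ y - z * w₁ y) * IccExtend zero_le_one (R z h) y) := by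
  have hI : uIoc (0 : ℝ) 1 = Ioc 0 1 := uIoc_of_le zero_le_one
  obtain ⟨T₀, hT₀⟩ := exists_kernel_operator hκ hκx hκy hw₀
  obtain ⟨T₁, hT₁⟩ := exists_kernel_operator hκ hκx hκy hw₁
  have hT : ∀ z f x, (T₀ - z • T₁) f x = ∫ y in (0 : ℝ)..1,
      (κ x y : ℂ) * ((w₀ y - z * w₁ y) * IccExtend zero_le_one f y) := by
    intro z f x
    simp only [sub_apply, smul_apply,
      ContinuousMap.sub_apply, ContinuousMap.smul_apply, smul_eq_mul, (hT₀ f x).2, (hT₁ f x).2]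
    rw [← intervalIntegral.integral_const_mul, ← intervalIntegral.integral_sub (hT₀ f x).1
      ((hT₁ f x).1.const_mul z)]
    refine intervalIntegral.integral_congr fun y _ => ?_
    ring
  have hunit : ∀ z : ℂ, IsUnit (1 - (T₀ - z • T₁)) := by
    intro z
    have hm : IntervalIntegrable (fun y => ‖w₀ y - z * w₁ y‖) volume 0 1 :=
      (hw₀.sub (hw₁.const_mul z)).norm
    refine isUnit_one_sub_of_volterra_bound _ hm (fun y => norm_nonneg _) hc fun f x => ?_
    have hsub : uIoc c (x : ℝ) ⊆ Ioc 0 1 := fun y hy =>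
      ⟨(le_min hc.1 x.2.1).trans_lt hy.1, hy.2.trans (max_le hc.2 x.2.2)⟩
    have h1 : ‖(T₀ - z • T₁) f x‖ = ‖∫ y in c..x,
        (κ x y : ℂ) * ((w₀ y - z * w₁ y) * IccExtend zero_le_one f y)‖ := by
      rw [hT, intervalIntegral.norm_intervalIntegral_eq, intervalIntegral.norm_intervalIntegral_eq,
        hI]
      congr 1
      -- The kernel vanishes outside the points between `c` and `x`, so the integral over `[0, 1]`
      -- is a Volterra integral.
      refine setIntegral_eq_of_subset_of_forall_sdiff_eq_zero measurableSet_Ioc hsub fun y hy => ?_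
      rw [hκc x y hy.1 hy.2]
      simp
    rw [h1]
    refine intervalIntegral.norm_integral_le_abs_of_norm_le ?_ ?_
    · filter_upwards [ae_restrict_mem measurableSet_uIoc] with y hy
      rw [norm_mul, norm_mul, Complex.norm_real, Real.norm_eq_abs]
      exact mul_le_of_le_one_left (by positivity) (hκ x y (hsub hy))
    · refine (hm.mono_set ?_).mul_continuousOn ?_
      · rw [uIcc_of_le (zero_le_one (α := ℝ))]
        exact uIcc_subset_Icc hc x.2
      · exact (f.continuous.Icc_extend').norm.continuousOn
  refine ⟨fun z => Ring.inverse (1 - (T₀ - z • T₁)), ?_, fun z h x => ?_⟩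
  · exact continuous_ringInverse_pencil T₀ T₁ hunit
  · rw [← hT]
    have h1 := Ring.mul_inverse_cancel _ (hunit z)
    have h2 : (1 - (T₀ - z • T₁)) (Ring.inverse (1 - (T₀ - z • T₁)) h) = h := by
      rw [← mul_apply_eq_comp, h1, one_apply_eq_self]
    rw [sub_apply, one_apply_eq_self, sub_eq_iff_eq_add] at h2
    exact congrArg (fun g : C(Icc (0 : ℝ) 1, ℂ) => g x) h2

/-! ### Quasi-derivatives and variation of parameters -/

theorem contDiffOn_one_of_hasDerivAt {f f' : ℝ → ℂ} {s : Set ℝ} (hs : IsOpen s)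
    (h : ∀ x ∈ s, HasDerivAt f (f' x) x) (hc : ContinuousOn f' s) : ContDiffOn ℝ 1 f s := by
  rw [show (1 : WithTop ℕ∞) = 0 + 1 by simp, contDiffOn_succ_iff_deriv_of_isOpen hs]
  exact ⟨fun x hx => (h x hx).differentiableAt.differentiableWithinAt, by simp,
    contDiffOn_zero.2 (hc.congr fun x hx => (h x hx).deriv)⟩

/-- `(f, β)` solves the first order system `f' = β / p`, `β' = p Q f` on `(0, 1)`, where `β` is
locally absolutely continuous: `f` is a solution of `(p f')' = p Q f` with quasi-derivative `β`. -/
structure IsQuasiSolution (p : ℝ → ℝ) (Q : ℝ → ℂ) (f β : ℝ → ℂ) : Prop where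
  hasDerivAt : ∀ x ∈ Ioo (0 : ℝ) 1, HasDerivAt f (β x / p x) x
  absolutelyContinuous : ∀ a b : ℝ, 0 < a → a ≤ b → b < 1 → AbsolutelyContinuousOnInterval β a b
  ae_hasDerivAt : ∀ᵐ x, x ∈ Ioo (0 : ℝ) 1 → HasDerivAt β (p x * Q x * f x) x

namespace IsQuasiSolution

variable {p : ℝ → ℝ} {Q : ℝ → ℂ} {f β f₁ β₁ f₂ β₂ : ℝ → ℂ}

theorem add (h₁ : IsQuasiSolution p Q f₁ β₁) (h₂ : IsQuasiSolution p Q f₂ β₂) :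
    IsQuasiSolution p Q (fun x => f₁ x + f₂ x) (fun x => β₁ x + β₂ x) where
  hasDerivAt x hx := by
    rw [add_div]
    exact (h₁.hasDerivAt x hx).add (h₂.hasDerivAt x hx)
  absolutelyContinuous a b ha hab hb :=
    (h₁.absolutelyContinuous a b ha hab hb).add (h₂.absolutelyContinuous a b ha hab hb)
  ae_hasDerivAt := by
    filter_upwards [h₁.ae_hasDerivAt, h₂.ae_hasDerivAt] with x hx₁ hx₂ hx
    rw [mul_add]
    exact (hx₁ hx).add (hx₂ hx)

theorem const_mul (h : IsQuasiSolution p Q f β) (c : ℂ) :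
    IsQuasiSolution p Q (fun x => c * f x) (fun x => c * β x) where
  hasDerivAt x hx := by
    rw [mul_div_assoc]
    exact (h.hasDerivAt x hx).const_mul c
  absolutelyContinuous a b ha hab hb := (h.absolutelyContinuous a b ha hab hb).const_smul c
  ae_hasDerivAt := by
    filter_upwards [h.ae_hasDerivAt] with x hx₁ hx
    rw [mul_left_comm]
    exact (hx₁ hx).const_mul c

theorem continuousOn_quasiDeriv (h : IsQuasiSolution p Q f β) : ContinuousOn β (Ioo 0 1) := by
  intro x hx
  have h1 := (h.absolutelyContinuous (x / 2) ((x + 1) / 2) (by linarith [hx.1])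
    (by linarith [hx.2]) (by linarith [hx.2])).continuousOn
  rw [uIcc_of_le (by linarith [hx.2])] at h1
  exact (h1.continuousAt (Icc_mem_nhds (by linarith [hx.1])
    (by linarith [hx.2]))).continuousWithinAt

theorem contDiffOn (hp : ContinuousOn p (Ioo 0 1)) (hp0 : ∀ x ∈ Ioo (0 : ℝ) 1, 0 < p x)
    (h : IsQuasiSolution p Q f β) : ContDiffOn ℝ 1 f (Ioo 0 1) := by
  refine contDiffOn_one_of_hasDerivAt isOpen_Ioo h.hasDerivAt
    (h.continuousOn_quasiDeriv.div (Complex.continuous_ofReal.comp_continuousOn hp) fun x hx => ?_)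
  exact_mod_cast (hp0 x hx).ne'

/-- The modified Wronskian of two solutions is constant. -/
theorem exists_wronskian_eq (hp : ContinuousOn p (Ioo 0 1)) (hp0 : ∀ x ∈ Ioo (0 : ℝ) 1, 0 < p x)
    (h₁ : IsQuasiSolution p Q f₁ β₁) (h₂ : IsQuasiSolution p Q f₂ β₂) :
    ∃ C : ℂ, ∀ x ∈ Ioo (0 : ℝ) 1, f₁ x * β₂ x - β₁ x * f₂ x = C := by
  set w : ℝ → ℂ := fun x => f₁ x * β₂ x - β₁ x * f₂ x with hw
  have hae : ∀ᵐ x, x ∈ Ioo (0 : ℝ) 1 → HasDerivAt w 0 x := by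
    filter_upwards [h₁.ae_hasDerivAt, h₂.ae_hasDerivAt] with x hx₁ hx₂ hx
    refine (((h₁.hasDerivAt x hx).mul (hx₂ hx)).sub
      ((hx₁ hx).mul (h₂.hasDerivAt x hx))).congr_deriv ?_
    ring
  have key : ∀ a b, 0 < a → a ≤ b → b < 1 → w a = w b := by
    intro a b ha hab hb
    have hsub : uIcc a b ⊆ Ioo 0 1 := by
      rw [uIcc_of_le hab]
      exact fun x hx => ⟨ha.trans_le hx.1, hx.2.trans_lt hb⟩
    -- Each product pairs a `C¹` solution with an absolutely continuous quasi-derivative, so an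
    -- almost everywhere zero derivative forces `w` to be constant.
    have hac : AbsolutelyContinuousOnInterval w a b :=
      ((((h₁.contDiffOn hp hp0).mono hsub).absolutelyContinuousOnInterval).fun_smul
        (h₂.absolutelyContinuous a b ha hab hb)).sub
      ((h₁.absolutelyContinuous a b ha hab hb).fun_smul
        (((h₂.contDiffOn hp hp0).mono hsub).absolutelyContinuousOnInterval))
    obtain ⟨C, hC⟩ := hac.const_of_ae_hasDerivAt_zero (by
      filter_upwards [hae] with x hx hxab using hx (hsub hxab))
    rw [hC a left_mem_uIcc, hC b right_mem_uIcc]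
  refine ⟨w (1 / 2), fun x hx => ?_⟩
  rcases le_total x (1 / 2) with h | h
  · exact key _ _ hx.1 h (by norm_num)
  · exact (key _ _ (by norm_num) h hx.2).symm

/-- Variation of parameters: `f = α - G β` with `α' = G r`, `β' = r`, `r = p Q f`. -/
theorem of_variation_of_parameters {G : ℝ → ℝ} (hp : ContinuousOn p (Ioo 0 1))
    (hp0 : ∀ x ∈ Ioo (0 : ℝ) 1, 0 < p x) (hG : ∀ x ∈ Ioo (0 : ℝ) 1, HasDerivAt G (-(p x)⁻¹) x)
    {r : ℝ → ℂ} {c : ℝ} (α₀ β₀ : ℂ)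
    (hr : ∀ x ∈ Ioo (0 : ℝ) 1, r x = p x * Q x * f x)
    (hri : ∀ x ∈ Ioo (0 : ℝ) 1, IntervalIntegrable r volume c x)
    (hGri : ∀ x ∈ Ioo (0 : ℝ) 1, IntervalIntegrable (fun y => (G y : ℂ) * r y) volume c x)
    (hf : ∀ x ∈ Ioo (0 : ℝ) 1,
      f x = α₀ + (∫ y in c..x, (G y : ℂ) * r y) - G x * (β₀ + ∫ y in c..x, r y)) :
    IsQuasiSolution p Q f fun x => β₀ + ∫ y in c..x, r y := by
  set β : ℝ → ℂ := fun x => β₀ + ∫ y in c..x, r y with hβ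
  set α : ℝ → ℂ := fun x => α₀ + ∫ y in c..x, (G y : ℂ) * r y with hα
  have hsub : ∀ {a b : ℝ}, 0 < a → a ≤ b → b < 1 → uIcc a b ⊆ Ioo 0 1 := by
    intro a b ha hab hb
    rw [uIcc_of_le hab]
    exact fun x hx => ⟨ha.trans_le hx.1, hx.2.trans_lt hb⟩
  have prim : ∀ {g : ℝ → ℂ} (γ₀ : ℂ), (∀ x ∈ Ioo (0 : ℝ) 1, IntervalIntegrable g volume c x) →
      ∀ {a b : ℝ}, 0 < a → a ≤ b → b < 1 →
      AbsolutelyContinuousOnInterval (fun x => γ₀ + ∫ y in c..x, g y) a b ∧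
      ∀ᵐ x, x ∈ uIcc a b → HasDerivAt (fun x => γ₀ + ∫ y in c..x, g y) (g x) x := by
    intro g γ₀ hg a b ha hab hb
    have hgab : IntervalIntegrable g volume a b :=
      (hg a (hsub ha hab hb left_mem_uIcc)).symm.trans (hg b (hsub ha hab hb right_mem_uIcc))
    have heq : ∀ x ∈ Ioo (0 : ℝ) 1, (γ₀ + ∫ y in c..a, g y) + ∫ y in a..x, g y
        = γ₀ + ∫ y in c..x, g y := by
      intro x hx
      have ha' := hg a (hsub ha hab hb left_mem_uIcc)
      rw [add_assoc, intervalIntegral.integral_add_adjacent_intervals ha'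
        (ha'.symm.trans (hg x hx))]
    constructor
    · refine ((AbsolutelyContinuousOnInterval.const (γ₀ + ∫ y in c..a, g y) a b).add
        (hgab.absolutelyContinuousOnInterval_integral left_mem_uIcc)).congr fun x hx => ?_
      exact heq x (hsub ha hab hb hx)
    · filter_upwards [hgab.ae_hasDerivAt_integral] with x hx hxab
      refine ((hx hxab a left_mem_uIcc).const_add (γ₀ + ∫ y in c..a, g y)).congr_of_eventuallyEq ?_
      filter_upwards [isOpen_Ioo.mem_nhds (hsub ha hab hb hxab)] with y hy using (heq y hy).symm
  have hβac : ∀ {a b : ℝ}, 0 < a → a ≤ b → b < 1 → AbsolutelyContinuousOnInterval β a b :=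
    fun ha hab hb => (prim β₀ hri ha hab hb).1
  have hβcont : ContinuousOn β (Ioo 0 1) := by
    intro x hx
    have h1 := (hβac (a := x / 2) (b := (x + 1) / 2) (by linarith [hx.1])
      (by linarith [hx.2]) (by linarith [hx.2])).continuousOn
    rw [uIcc_of_le (by linarith [hx.2])] at h1
    exact (h1.continuousAt (Icc_mem_nhds (by linarith [hx.1])
      (by linarith [hx.2]))).continuousWithinAt
  have hpc : ContinuousOn (fun x => (p x : ℂ)) (Ioo 0 1) :=
    Complex.continuous_ofReal.comp_continuousOn hp
  have hpne : ∀ x ∈ Ioo (0 : ℝ) 1, (p x : ℂ) ≠ 0 := fun x hx => by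
    exact_mod_cast (hp0 x hx).ne'
  have hg : ContinuousOn (fun x => β x / p x) (Ioo 0 1) := hβcont.div hpc hpne
  have hGd : ∀ x ∈ Ioo (0 : ℝ) 1, HasDerivAt (fun x => (G x : ℂ)) (-(p x : ℂ)⁻¹) x := by
    intro x hx
    simpa using (hG x hx).ofReal_comp
  have hGC : ContDiffOn ℝ 1 (fun x => (G x : ℂ)) (Ioo 0 1) :=
    contDiffOn_one_of_hasDerivAt isOpen_Ioo hGd (hpc.inv₀ hpne).neg
  refine ⟨fun x hx => ?_, fun a b ha hab hb => hβac ha hab hb, ?_⟩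
  · obtain ⟨a, ha0, hax⟩ := exists_between hx.1
    obtain ⟨b, hxb, hb1⟩ := exists_between hx.2
    have hab : a ≤ b := (hax.trans hxb).le
    have hs := hsub ha0 hab hb1
    have hgi : IntervalIntegrable (fun x => β x / p x) volume a b :=
      (hg.mono hs).intervalIntegrable
    -- `α` and `β` are differentiable only almost everywhere, but `f` must be so everywhere. In `(α
    -- - G β)'` the terms `G r` cancel and `β / p` is left, so `f` differs by a constant from a
    -- primitive of the continuous function `β / p`.
    have hac : AbsolutelyContinuousOnInterval
        (fun x => (α x - (G x : ℂ) • β x) - ∫ y in a..x, β y / p y) a b :=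
      ((prim α₀ hGri ha0 hab hb1).1.fun_sub
        ((hGC.mono hs).absolutelyContinuousOnInterval.fun_smul (hβac ha0 hab hb1))).fun_sub
        (hgi.absolutelyContinuousOnInterval_integral left_mem_uIcc)
    obtain ⟨C, hC⟩ := hac.const_of_ae_hasDerivAt_zero (by
      filter_upwards [(prim α₀ hGri ha0 hab hb1).2, (prim β₀ hri ha0 hab hb1).2,
        hgi.ae_hasDerivAt_integral] with y hy₁ hy₂ hy₃ hy
      refine (((hy₁ hy).sub ((hGd y (hs hy)).mul (hy₂ hy))).sub
        (hy₃ hy a left_mem_uIcc)).congr_deriv ?_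
      simp only [hβ]
      ring)
    have hd : HasDerivAt (fun y => C + ∫ t in a..y, β t / p t) (β x / p x) x := by
      have hxab : x ∈ uIcc a b := by rw [uIcc_of_le hab]; exact ⟨hax.le, hxb.le⟩
      refine (intervalIntegral.integral_hasDerivAt_right
        (hgi.mono_set (uIcc_subset_uIcc left_mem_uIcc hxab)) ?_
        (hg.continuousAt (isOpen_Ioo.mem_nhds hx))).const_add C
      exact hg.stronglyMeasurableAtFilter isOpen_Ioo x hx
    refine hd.congr_of_eventuallyEq ?_
    filter_upwards [Ioo_mem_nhds hax hxb] with y hy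
    have hyab : y ∈ uIcc a b := by rw [uIcc_of_le hab]; exact Ioo_subset_Icc_self hy
    rw [hf y (hs hyab), ← hC y hyab, smul_eq_mul]
    ring
  -- Countably many compact intervals exhaust `(0, 1)`, which yields one null set. The shift by `2`
  -- keeps their endpoints in order.
  · have hn : ∀ n : ℕ, ∀ᵐ x, x ∈ uIcc (1 / ((n : ℝ) + 2)) (1 - 1 / ((n : ℝ) + 2)) →
        HasDerivAt β (r x) x := by
      intro n
      have h1 : 1 / ((n : ℝ) + 2) ≤ 1 / 2 := by
        apply one_div_le_one_div_of_le <;> linarith [n.cast_nonneg (α := ℝ)]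
      have h2 : 0 < 1 / ((n : ℝ) + 2) := by positivity
      exact (prim β₀ hri h2 (by linarith) (by linarith)).2
    filter_upwards [ae_all_iff.2 hn] with x hx hx01
    rw [← hr x hx01]
    obtain ⟨n, hn⟩ := exists_nat_one_div_lt (lt_min hx01.1 (sub_pos.2 hx01.2))
    have h3 : 1 / ((n : ℝ) + 2) ≤ 1 / ((n : ℝ) + 1) := by
      apply one_div_le_one_div_of_le <;> linarith [n.cast_nonneg (α := ℝ)]
    have h4 := h3.trans_lt hn
    refine hx n (Icc_subset_uIcc ⟨(h4.trans_le (min_le_left _ _)).le, ?_⟩)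
    linarith [h4.trans_le (min_le_right _ _)]

end IsQuasiSolution

/-! ### Regular and singular solutions of the reduced equation -/

/-- `1 / γ` is a non-principal solution at `0` of `(p f')' = 0` on `(0, 1)`, normalized to be
positive with `p (1 / γ)' = -1`. -/
structure IsNonprincipalWeight (p γ : ℝ → ℝ) : Prop where
  continuousOn_coeff : ContinuousOn p (Ioo 0 1)
  coeff_pos : ∀ x ∈ Ioo (0 : ℝ) 1, 0 < p x
  continuousOn : ContinuousOn γ (Icc 0 1)
  zero : γ 0 = 0
  pos : ∀ x ∈ Ioc (0 : ℝ) 1, 0 < γ x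
  monotoneOn : MonotoneOn γ (Icc 0 1)
  hasDerivAt_inv : ∀ x ∈ Ioo (0 : ℝ) 1, HasDerivAt (fun x => (γ x)⁻¹) (-(p x)⁻¹) x

theorem tendsto_primitive_endpoints {f : ℝ → ℂ} {a b c : ℝ} (hab : a < b)
    (hf : IntervalIntegrable f volume a b) (hc : c ∈ Icc a b) :
    Tendsto (fun x => ∫ y in c..x, f y) (𝓝[>] a) (𝓝 (∫ y in c..a, f y)) ∧
    Tendsto (fun x => ∫ y in c..x, f y) (𝓝[<] b) (𝓝 (∫ y in c..b, f y)) := by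
  have h := (hf.absolutelyContinuousOnInterval_integral
    (show c ∈ uIcc a b by rwa [uIcc_of_le hab.le])).continuousOn
  rw [uIcc_of_le hab.le] at h
  have h1 := (h a (left_mem_Icc.2 hab.le)).mono (Ioo_subset_Icc_self (a := a) (b := b))
  have h2 := (h b (right_mem_Icc.2 hab.le)).mono (Ioo_subset_Icc_self (a := a) (b := b))
  rw [ContinuousWithinAt, nhdsWithin_Ioo_eq_nhdsGT hab] at h1
  rw [ContinuousWithinAt, nhdsWithin_Ioo_eq_nhdsLT hab] at h2
  exact ⟨h1, h2⟩

namespace IsNonprincipalWeight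

variable {p γ : ℝ → ℝ} {q₀ : ℝ → ℂ}

/-- The solution that is regular at `0`. -/
theorem exists_regular_solution (hγ : IsNonprincipalWeight p γ)
    (hw₀ : IntervalIntegrable (fun y => (p y / γ y : ℝ) * q₀ y) volume 0 1)
    (hw₁ : IntervalIntegrable (fun y => ((p y / γ y : ℝ) : ℂ)) volume 0 1) :
    ∃ u : ℂ → C(Icc (0 : ℝ) 1, ℂ), Continuous u ∧ ∀ z, u z 0 = 1 ∧ ∃ β : ℝ → ℂ,
      IsQuasiSolution p (fun x => q₀ x - z) (IccExtend zero_le_one (u z)) β ∧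
      Tendsto (fun x => β x / γ x) (𝓝[>] 0) (𝓝 0) := by
  have hII : uIcc (0 : ℝ) 1 = Icc 0 1 := uIcc_of_le zero_le_one
  have h0 : ∀ x ∈ Icc (0 : ℝ) 1, 0 ≤ γ x := fun x hx => by
    simpa [hγ.zero] using hγ.monotoneOn (left_mem_Icc.2 zero_le_one) hx hx.1
  have hmax : ∀ (x : Icc (0 : ℝ) 1), ∀ y ∈ Ioc (0 : ℝ) 1, 0 < max (γ x) (γ y) := fun x y hy =>
    lt_max_of_lt_right (hγ.pos y hy)
  -- Variation of parameters gives the kernel `1 - γ y / γ x` for `y ≤ x`. The maximum cuts it off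
  -- to `0` for `y ≥ x`, continuously across the diagonal and down to `x = 0`.
  obtain ⟨R, hR, hRe⟩ := exists_volterra_resolvent (c := 0)
    (κ := fun x y => 1 - γ y / max (γ x) (γ y)) (left_mem_Icc.2 zero_le_one)
    (fun x y hy => by
      have h1 : 0 ≤ γ y / max (γ x) (γ y) := div_nonneg (hγ.pos y hy).le (hmax x y hy).le
      have h2 : γ y / max (γ x) (γ y) ≤ 1 := div_le_one_of_le₀ (le_max_right _ _) (hmax x y hy).le
      rw [abs_le]; constructor <;> linarith)
    (fun y hy => by
      have h1 : Continuous fun x : Icc (0 : ℝ) 1 => γ x := hγ.continuousOn.domRestrict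
      exact continuous_const.sub (continuous_const.div (h1.max continuous_const)
        fun x => (hmax x y hy).ne'))
    (fun x => by
      have h1 : ContinuousOn γ (Ioc 0 1) := hγ.continuousOn.mono Ioc_subset_Icc_self
      exact continuousOn_const.sub (h1.div (continuousOn_const.sup h1)
        fun y hy => (hmax x y hy).ne'))
    (fun x y hy hyx => by
      have hxy : (x : ℝ) ≤ y := by
        by_contra h
        exact hyx ⟨by simpa [x.2.1] using hy.1, (not_le.1 h).le.trans (le_max_right _ _)⟩
      have h1 := hγ.monotoneOn x.2 (Ioc_subset_Icc_self hy) hxy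
      simp only [max_eq_right h1, div_self (hγ.pos y hy).ne', sub_self])
    hw₀ hw₁
  refine ⟨fun z => R z 1, hR.clm_apply continuous_const, fun z => ?_⟩
  set u := R z 1 with hu
  set U : ℝ → ℂ := IccExtend zero_le_one u with hU
  set w : ℝ → ℂ := fun y => (p y / γ y : ℝ) * q₀ y - z * (p y / γ y : ℝ) with hw
  have hRe' : ∀ x : Icc (0 : ℝ) 1, u x = 1 + ∫ y in (0 : ℝ)..1,
      ((1 - γ y / max (γ x) (γ y) : ℝ) : ℂ) * (w y * U y) := fun x => hRe z 1 x
  have hUc : Continuous U := u.continuous.Icc_extend'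
  have hwU : IntervalIntegrable (fun y => w y * U y) volume 0 1 :=
    (hw₀.sub (hw₁.const_mul z)).mul_continuousOn hUc.continuousOn
  have hr : IntervalIntegrable (fun y => (γ y : ℂ) * (w y * U y)) volume 0 1 :=
    hwU.continuousOn_mul (Complex.continuous_ofReal.comp_continuousOn (hII ▸ hγ.continuousOn))
  have hsub : ∀ x ∈ Icc (0 : ℝ) 1, uIcc 0 x ⊆ uIcc 0 1 := fun x hx =>
    uIcc_subset_uIcc left_mem_uIcc (hII ▸ hx)
  have heqG : ∀ x ∈ Icc (0 : ℝ) 1, ∀ y ∈ uIoc 0 x,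
      w y * U y = ((γ y)⁻¹ : ℝ) * ((γ y : ℂ) * (w y * U y)) := by
    intro x hx y hy
    rw [uIoc_of_le hx.1] at hy
    have := (hγ.pos y ⟨hy.1, hy.2.trans hx.2⟩).ne'
    have h2 : (γ y : ℂ) ≠ 0 := by exact_mod_cast this
    push_cast
    field_simp
  have hue : ∀ x ∈ Ioc (0 : ℝ) 1, U x = 1 + ((∫ y in (0 : ℝ)..x, w y * U y) -
      ((γ x)⁻¹ : ℝ) * ∫ y in (0 : ℝ)..x, (γ y : ℂ) * (w y * U y)) := by
    intro x hx
    have hx' := Ioc_subset_Icc_self hx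
    rw [hU, IccExtend_of_mem _ _ hx', ← hU, hRe' ⟨x, hx'⟩,
      ← intervalIntegral.integral_const_mul, ← intervalIntegral.integral_sub
      (hwU.mono_set (hsub x hx')) ((hr.mono_set (hsub x hx')).const_mul _),
      intervalIntegral.integral_of_le zero_le_one, intervalIntegral.integral_of_le hx.1.le]
    congr 1
    rw [setIntegral_eq_of_subset_of_forall_sdiff_eq_zero measurableSet_Ioc
      (Ioc_subset_Ioc_right hx.2) ?_]
    · refine setIntegral_congr_fun measurableSet_Ioc fun y hy => ?_
      have h1 := hγ.monotoneOn ⟨hy.1.le, hy.2.trans hx.2⟩ hx' hy.2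
      simp only [max_eq_left h1]
      push_cast
      ring
    · intro y hy
      have hxy : x ≤ y := by
        by_contra h
        exact hy.2 ⟨hy.1.1, (not_le.1 h).le⟩
      have h1 := hγ.monotoneOn hx' (Ioc_subset_Icc_self hy.1) hxy
      simp only [max_eq_right h1, div_self (hγ.pos y hy.1).ne', sub_self]
      simp
  constructor
  · change u 0 = 1
    rw [hRe' 0, intervalIntegral.integral_of_le zero_le_one,
      setIntegral_eq_zero_of_forall_eq_zero, add_zero]
    intro y hy
    have h2 : max (γ ((0 : Icc (0 : ℝ) 1) : ℝ)) (γ y) = γ y := by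
      rw [show ((0 : Icc (0 : ℝ) 1) : ℝ) = 0 from rfl, hγ.zero]
      exact max_eq_right (hγ.pos y hy).le
    simp only [h2, div_self (hγ.pos y hy).ne', sub_self]
    simp
  · refine ⟨_, IsQuasiSolution.of_variation_of_parameters (c := 0) (G := fun x => (γ x)⁻¹)
      (r := fun y => (γ y : ℂ) * (w y * U y)) hγ.continuousOn_coeff hγ.coeff_pos
      hγ.hasDerivAt_inv 1 0 ?_ ?_ ?_ ?_, ?_⟩
    · intro x hx
      have : (γ x : ℂ) ≠ 0 := by exact_mod_cast (hγ.pos x (Ioo_subset_Ioc_self hx)).ne'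
      simp only [hw]
      push_cast
      field_simp
    · exact fun x hx => hr.mono_set (hsub x (Ioo_subset_Icc_self hx))
    · intro x hx
      have hx' := Ioo_subset_Icc_self hx
      exact (hwU.mono_set (hsub x hx')).congr (heqG x hx')
    · intro x hx
      have hx' := Ioo_subset_Icc_self hx
      rw [hue x (Ioo_subset_Ioc_self hx), zero_add, ← add_sub_assoc]
      congr 2
      refine intervalIntegral.integral_congr_ae (Eventually.of_forall (heqG x hx'))
    -- Since `γ` is monotone, `|β x| ≤ γ x ∫₀ˣ |w U|`, and the last integral tends to `0`.
    · have h1 : Tendsto (fun x => ∫ y in (0 : ℝ)..x, ((‖w y * U y‖ : ℝ) : ℂ)) (𝓝[>] 0) (𝓝 0) := by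
        have h3 : IntervalIntegrable (fun y => ((‖w y * U y‖ : ℝ) : ℂ)) volume 0 1 :=
          ⟨hwU.norm.1.ofReal, hwU.norm.2.ofReal⟩
        simpa using (tendsto_primitive_endpoints zero_lt_one h3 (left_mem_Icc.2 zero_le_one)).1
      refine squeeze_zero_norm' ?_ (tendsto_zero_iff_norm_tendsto_zero.1 h1)
      filter_upwards [Ioo_mem_nhdsGT (zero_lt_one (α := ℝ))] with x hx
      have hx' := Ioo_subset_Icc_self hx
      have hpos := hγ.pos x (Ioo_subset_Ioc_self hx)
      rw [zero_add, norm_div, Complex.norm_real, Real.norm_of_nonneg hpos.le, div_le_iff₀ hpos,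
        intervalIntegral.integral_ofReal, Complex.norm_real, Real.norm_of_nonneg
        (intervalIntegral.integral_nonneg hx.1.le fun _ _ => norm_nonneg _),
        ← intervalIntegral.integral_mul_const]
      refine intervalIntegral.norm_integral_le_of_norm_le hx.1.le (Eventually.of_forall ?_)
        ((hwU.mono_set (hsub x hx')).norm.mul_const _)
      intro y hy
      have hy' : y ∈ Icc (0 : ℝ) 1 := ⟨hy.1.le, hy.2.trans hx.2.le⟩
      rw [norm_mul, Complex.norm_real, Real.norm_of_nonneg (h0 y hy'), mul_comm]
      exact mul_le_mul_of_nonneg_left (hγ.monotoneOn hy' hx' hy.2) (norm_nonneg _)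

/-- The solution with given Cauchy data at `1`. -/
theorem exists_solution_of_data_at_one (hγ : IsNonprincipalWeight p γ)
    (hw₀ : IntervalIntegrable (fun y => (p y / γ y : ℝ) * q₀ y) volume 0 1)
    (hw₁ : IntervalIntegrable (fun y => ((p y / γ y : ℝ) : ℂ)) volume 0 1) (α₀ β₀ : ℂ) :
    ∃ v : ℂ → C(Icc (0 : ℝ) 1, ℂ), Continuous v ∧ ∀ z, v z 1 = α₀ * γ 1 - β₀ ∧ ∃ β : ℝ → ℂ,
      IsQuasiSolution p (fun x => q₀ x - z) (fun x => IccExtend zero_le_one (v z) x / γ x) β ∧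
      Tendsto β (𝓝[>] 0) (𝓝 (-v z 0)) ∧ Tendsto β (𝓝[<] 1) (𝓝 β₀) := by
  have hII : uIcc (0 : ℝ) 1 = Icc 0 1 := uIcc_of_le zero_le_one
  have h0 : ∀ x ∈ Icc (0 : ℝ) 1, 0 ≤ γ x := fun x hx => by
    simpa [hγ.zero] using hγ.monotoneOn (left_mem_Icc.2 zero_le_one) hx hx.1
  have hγc : Continuous fun x : Icc (0 : ℝ) 1 => γ x := hγ.continuousOn.domRestrict
  -- The unknown is `v = γ f`: multiplying variation of parameters from `1` by `γ x` gives the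
  -- kernel `1 - γ x / γ y` for `y ≥ x`, which the minimum cuts off below `x`.
  obtain ⟨R, hR, hRe⟩ := exists_volterra_resolvent (c := 1)
    (κ := fun x y => 1 - min (γ x) (γ y) / γ y) (right_mem_Icc.2 zero_le_one)
    (fun x y hy => by
      have h1 : 0 ≤ min (γ x) (γ y) / γ y :=
        div_nonneg (le_min (h0 x x.2) (hγ.pos y hy).le) (hγ.pos y hy).le
      have h2 : min (γ x) (γ y) / γ y ≤ 1 := div_le_one_of_le₀ (min_le_right _ _) (hγ.pos y hy).le
      rw [abs_le]; constructor <;> linarith)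
    (fun y hy => continuous_const.sub ((hγc.min continuous_const).div_const _))
    (fun x => by
      have h1 : ContinuousOn γ (Ioc 0 1) := hγ.continuousOn.mono Ioc_subset_Icc_self
      exact continuousOn_const.sub ((continuousOn_const.inf h1).div h1
        fun y hy => (hγ.pos y hy).ne'))
    (fun x y hy hyx => by
      have hxy : y ≤ (x : ℝ) := by
        by_contra h
        exact hyx ⟨(min_le_right _ _).trans_lt (not_le.1 h), by simpa [x.2.2] using hy.2⟩
      have h1 := hγ.monotoneOn (Ioc_subset_Icc_self hy) x.2 hxy
      simp only [min_eq_right h1, div_self (hγ.pos y hy).ne', sub_self])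
    hw₀ hw₁
  -- This is `γ` times the free solution `α₀ - β₀ / γ`.
  let h : C(Icc (0 : ℝ) 1, ℂ) := ⟨fun x => α₀ * γ x - β₀,
    (continuous_const.mul (Complex.continuous_ofReal.comp hγc)).sub continuous_const⟩
  refine ⟨fun z => R z h, hR.clm_apply continuous_const, fun z => ?_⟩
  set v := R z h with hv
  set V : ℝ → ℂ := IccExtend zero_le_one v with hV
  set w : ℝ → ℂ := fun y => (p y / γ y : ℝ) * q₀ y - z * (p y / γ y : ℝ) with hw
  have hRe' : ∀ x : Icc (0 : ℝ) 1, v x = (α₀ * γ x - β₀) + ∫ y in (0 : ℝ)..1,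
      ((1 - min (γ x) (γ y) / γ y : ℝ) : ℂ) * (w y * V y) := fun x => hRe z h x
  have hVc : Continuous V := v.continuous.Icc_extend'
  have hwV : IntervalIntegrable (fun y => w y * V y) volume 0 1 :=
    (hw₀.sub (hw₁.const_mul z)).mul_continuousOn hVc.continuousOn
  have hsub : ∀ x ∈ Icc (0 : ℝ) 1, uIcc 1 x ⊆ uIcc 0 1 := fun x hx =>
    uIcc_subset_uIcc right_mem_uIcc (hII ▸ hx)
  have hGi : ∀ x ∈ Ioc (0 : ℝ) 1, IntervalIntegrable
      (fun y => (((γ y)⁻¹ : ℝ) : ℂ) * (w y * V y)) volume 1 x := by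
    intro x hx
    have h1 : uIcc 1 x ⊆ Ioc 0 1 := by
      rw [uIcc_of_ge hx.2]
      exact fun y hy => ⟨hx.1.trans_le hy.1, hy.2⟩
    refine (hwV.mono_set (hsub x (Ioc_subset_Icc_self hx))).continuousOn_mul
      (Complex.continuous_ofReal.comp_continuousOn (ContinuousOn.inv₀
        (hγ.continuousOn.mono (h1.trans Ioc_subset_Icc_self)) fun y hy => ?_))
    exact (hγ.pos y (h1 hy)).ne'
  have hve : ∀ x ∈ Ioc (0 : ℝ) 1, V x = α₀ * γ x - β₀ + (γ x *
      (∫ y in (1 : ℝ)..x, (((γ y)⁻¹ : ℝ) : ℂ) * (w y * V y)) - ∫ y in (1 : ℝ)..x, w y * V y) := by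
    intro x hx
    have hx' := Ioc_subset_Icc_self hx
    rw [hV, IccExtend_of_mem _ _ hx', ← hV, hRe' ⟨x, hx'⟩]
    rw [← intervalIntegral.integral_const_mul, ← intervalIntegral.integral_sub
      ((hGi x hx).const_mul _) (hwV.mono_set (hsub x hx')),
      intervalIntegral.integral_of_le zero_le_one, intervalIntegral.integral_of_ge hx.2,
      ← integral_neg]
    congr 1
    rw [setIntegral_eq_of_subset_of_forall_sdiff_eq_zero measurableSet_Ioc
      (Ioc_subset_Ioc_left hx.1.le) ?_]
    · refine setIntegral_congr_fun measurableSet_Ioc fun y hy => ?_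
      have h1 := hγ.monotoneOn hx' ⟨hx.1.le.trans hy.1.le, hy.2⟩ hy.1.le
      simp only [min_eq_left h1]
      push_cast
      ring
    · intro y hy
      have hxy : y ≤ x := by
        by_contra h
        exact hy.2 ⟨not_le.1 h, hy.1.2⟩
      have h1 := hγ.monotoneOn (Ioc_subset_Icc_self hy.1) hx' hxy
      simp only [min_eq_right h1, div_self (hγ.pos y hy.1).ne', sub_self]
      simp
  have hlim := tendsto_primitive_endpoints zero_lt_one hwV (right_mem_Icc.2 zero_le_one)
  have hv1 : v 1 = α₀ * γ 1 - β₀ := by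
    have h1 := hve 1 (right_mem_Ioc.2 zero_lt_one)
    simp only [intervalIntegral.integral_same, mul_zero, sub_zero, add_zero] at h1
    rw [← h1, hV, IccExtend_of_mem _ _ (right_mem_Icc.2 zero_le_one)]
    rfl
  -- At `x = 0` the kernel is identically `1`, so `v 0` is minus the limit of the quasi-derivative
  -- at `0`.
  have hv0 : v 0 = -β₀ + ∫ y in (0 : ℝ)..1, w y * V y := by
    rw [hRe' 0]
    congr 1
    · rw [show ((0 : Icc (0 : ℝ) 1) : ℝ) = 0 from rfl, hγ.zero]
      simp
    · rw [intervalIntegral.integral_of_le zero_le_one, intervalIntegral.integral_of_le zero_le_one]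
      refine setIntegral_congr_fun measurableSet_Ioc fun y hy => ?_
      have h2 : min (γ ((0 : Icc (0 : ℝ) 1) : ℝ)) (γ y) = 0 := by
        rw [show ((0 : Icc (0 : ℝ) 1) : ℝ) = 0 from rfl, hγ.zero]
        exact min_eq_left (hγ.pos y hy).le
      simp only [h2]
      simp
  refine ⟨hv1, _, IsQuasiSolution.of_variation_of_parameters (c := 1) (G := fun x => (γ x)⁻¹)
      (r := fun y => w y * V y) hγ.continuousOn_coeff hγ.coeff_pos
      hγ.hasDerivAt_inv α₀ β₀ ?_ ?_ ?_ ?_, ?_, ?_⟩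
  · intro x hx
    have : (γ x : ℂ) ≠ 0 := by exact_mod_cast (hγ.pos x (Ioo_subset_Ioc_self hx)).ne'
    simp only [hw]
    push_cast
    field_simp
  · exact fun x hx => hwV.mono_set (hsub x (Ioo_subset_Icc_self hx))
  · exact fun x hx => hGi x (Ioo_subset_Ioc_self hx)
  · intro x hx
    have : (γ x : ℂ) ≠ 0 := by exact_mod_cast (hγ.pos x (Ioo_subset_Ioc_self hx)).ne'
    rw [hve x (Ioo_subset_Ioc_self hx), div_eq_iff this]
    push_cast
    field_simp
    ring
  · rw [hv0, neg_add, neg_neg, ← intervalIntegral.integral_symm]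
    exact hlim.1.const_add β₀
  · simpa using hlim.2.const_add β₀

/-- A solution regular at `0` and a singular one with modified Wronskian `1`, both depending
continuously on the spectral parameter. -/
theorem exists_solution_pair (hγ : IsNonprincipalWeight p γ)
    (hw₀ : IntervalIntegrable (fun y => (p y / γ y : ℝ) * q₀ y) volume 0 1)
    (hw₁ : IntervalIntegrable (fun y => ((p y / γ y : ℝ) : ℂ)) volume 0 1) :
    ∃ u v : ℂ → C(Icc (0 : ℝ) 1, ℂ), Continuous u ∧ Continuous v ∧
      ∀ z, u z 0 = 1 ∧ v z 0 = 1 ∧ ∃ β β' : ℝ → ℂ,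
      IsQuasiSolution p (fun x => q₀ x - z) (IccExtend zero_le_one (u z)) β ∧
      IsQuasiSolution p (fun x => q₀ x - z) (fun x => IccExtend zero_le_one (v z) x / γ x) β' ∧
      ∀ x ∈ Ioo (0 : ℝ) 1, IccExtend zero_le_one (v z) x / γ x * β x -
        β' x * IccExtend zero_le_one (u z) x = 1 := by
  obtain ⟨u, huc, hu⟩ := hγ.exists_regular_solution hw₀ hw₁
  have hlim0 : ∀ f : C(Icc (0 : ℝ) 1, ℂ),
      Tendsto (IccExtend zero_le_one f) (𝓝[>] 0) (𝓝 (f 0)) := by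
    intro f
    have h1 := (f.continuous.Icc_extend' (h := zero_le_one)).tendsto 0
    rw [IccExtend_of_mem _ _ (left_mem_Icc.2 zero_le_one)] at h1
    exact h1.mono_left nhdsWithin_le_nhds
  have hlim1 : ∀ f : C(Icc (0 : ℝ) 1, ℂ),
      Tendsto (IccExtend zero_le_one f) (𝓝[<] 1) (𝓝 (f 1)) := by
    intro f
    have h1 := (f.continuous.Icc_extend' (h := zero_le_one)).tendsto 1
    rw [IccExtend_of_mem _ _ (right_mem_Icc.2 zero_le_one)] at h1
    exact h1.mono_left nhdsWithin_le_nhds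
  -- The constant Wronskian is evaluated at `0`: in the first product `1 / γ` is absorbed by `β / γ
  -- → 0`, and the second tends to `-v 0`.
  have hwr : ∀ z (v : C(Icc (0 : ℝ) 1, ℂ)) (β β' : ℝ → ℂ),
      IsQuasiSolution p (fun x => q₀ x - z) (IccExtend zero_le_one (u z)) β →
      Tendsto (fun x => β x / γ x) (𝓝[>] 0) (𝓝 0) →
      IsQuasiSolution p (fun x => q₀ x - z) (fun x => IccExtend zero_le_one v x / γ x) β' →
      Tendsto β' (𝓝[>] 0) (𝓝 (-v 0)) → ∀ x ∈ Ioo (0 : ℝ) 1,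
      IccExtend zero_le_one v x / γ x * β x - β' x * IccExtend zero_le_one (u z) x = v 0 := by
    intro z v β β' h1 h2 h3 h4
    obtain ⟨C, hC⟩ := h3.exists_wronskian_eq hγ.continuousOn_coeff hγ.coeff_pos h1
    have hL := ((hlim0 v).mul h2).sub (h4.mul (hlim0 (u z)))
    rw [(hu z).1, mul_zero, mul_one, zero_sub, neg_neg] at hL
    have hC' : Tendsto (fun _ : ℝ => C) (𝓝[>] (0 : ℝ)) (𝓝 (v 0)) := by
      refine hL.congr' ?_
      filter_upwards [Ioo_mem_nhdsGT (zero_lt_one (α := ℝ))] with x hx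
      rw [← hC x hx]
      ring
    rwa [← tendsto_nhds_unique tendsto_const_nhds hC']
  obtain ⟨v₁, hv₁c, hv₁⟩ := hγ.exists_solution_of_data_at_one hw₀ hw₁ 1 0
  obtain ⟨v₂, hv₂c, hv₂⟩ := hγ.exists_solution_of_data_at_one hw₀ hw₁ 0 (-1)
  -- If both values vanished, `u` would have zero Wronskian with two solutions whose own Wronskian,
  -- read off at `1`, is `-1`. Then `u = 0` on `(0, 1)`, against `u 0 = 1`.
  have hne : ∀ z, Complex.normSq (v₁ z 0) + Complex.normSq (v₂ z 0) ≠ 0 := by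
    intro z hz
    have hz₁ : v₁ z 0 = 0 := Complex.normSq_eq_zero.1 (by
      linarith [Complex.normSq_nonneg (v₁ z 0), Complex.normSq_nonneg (v₂ z 0)])
    have hz₂ : v₂ z 0 = 0 := Complex.normSq_eq_zero.1 (by
      linarith [Complex.normSq_nonneg (v₁ z 0), Complex.normSq_nonneg (v₂ z 0)])
    obtain ⟨hu0, β, hβ, hβ0⟩ := hu z
    obtain ⟨h11, β₁, hβ₁, hβ₁0, hβ₁1⟩ := hv₁ z
    obtain ⟨-, β₂, hβ₂, hβ₂0, hβ₂1⟩ := hv₂ z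
    obtain ⟨C, hC⟩ := hβ₁.exists_wronskian_eq hγ.continuousOn_coeff hγ.coeff_pos hβ₂
    have hγ1 : Tendsto (fun x => (γ x : ℂ)) (𝓝[<] 1) (𝓝 (γ 1)) := by
      have h1 := (hγ.continuousOn 1 (right_mem_Icc.2 zero_le_one)).mono
        (Ioo_subset_Icc_self (a := 0) (b := 1))
      rw [ContinuousWithinAt, nhdsWithin_Ioo_eq_nhdsLT zero_lt_one] at h1
      exact (Complex.continuous_ofReal.tendsto _).comp h1
    have hγne : (γ 1 : ℂ) ≠ 0 := by exact_mod_cast (hγ.pos 1 (right_mem_Ioc.2 zero_lt_one)).ne'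
    have hL := ((((hlim1 (v₁ z)).div hγ1 hγne).mul hβ₂1).sub
      (hβ₁1.mul ((hlim1 (v₂ z)).div hγ1 hγne)))
    rw [h11, one_mul, sub_zero, div_self hγne, zero_mul, sub_zero, one_mul] at hL
    have hC1 : C = -1 := by
      refine tendsto_nhds_unique (Tendsto.congr' ?_ hL) tendsto_const_nhds |>.symm
      filter_upwards [Ioo_mem_nhdsLT (zero_lt_one (α := ℝ))] with x hx using hC x hx
    have hU0 : ∀ x ∈ Ioo (0 : ℝ) 1, IccExtend zero_le_one (u z) x = 0 := by
      intro x hx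
      have h1 := hwr z (v₁ z) β β₁ hβ hβ0 hβ₁ hβ₁0 x hx
      have h2 := hwr z (v₂ z) β β₂ hβ hβ0 hβ₂ hβ₂0 x hx
      have h3 := hC x hx
      rw [hz₁] at h1
      rw [hz₂] at h2
      rw [hC1] at h3
      linear_combination (IccExtend zero_le_one (v₁ z) x / γ x) * h2 -
        (IccExtend zero_le_one (v₂ z) x / γ x) * h1 + (IccExtend zero_le_one (u z) x) * h3
    have h4 : (1 : ℂ) = 0 := by
      rw [← hu0]
      refine tendsto_nhds_unique ((hlim0 (u z)).congr' ?_) tendsto_const_nhds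
      filter_upwards [Ioo_mem_nhdsGT (zero_lt_one (α := ℝ))] with x hx using hU0 x hx
    exact one_ne_zero h4
  have hev : Continuous fun f : C(Icc (0 : ℝ) 1, ℂ) => f 0 :=
    continuous_eval_const 0
  -- The coefficients `conj (vᵢ 0) / d` normalize `v 0` to `1` without choosing which `vᵢ 0` is
  -- nonzero, so they are continuous in `z`.
  set d : ℂ → ℂ := fun z => ((Complex.normSq (v₁ z 0) + Complex.normSq (v₂ z 0) : ℝ) : ℂ) with hd
  have hdne : ∀ z, d z ≠ 0 := fun z =>
    Complex.ofReal_ne_zero.2 (hne z)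
  have hdc : Continuous d := Complex.continuous_ofReal.comp
    ((Complex.continuous_normSq.comp (hev.comp hv₁c)).add
      (Complex.continuous_normSq.comp (hev.comp hv₂c)))
  set c₁ : ℂ → ℂ := fun z => (starRingEnd ℂ) (v₁ z 0) / d z with hc₁
  set c₂ : ℂ → ℂ := fun z => (starRingEnd ℂ) (v₂ z 0) / d z with hc₂
  have hc₁c : Continuous c₁ := (Complex.continuous_conj.comp (hev.comp hv₁c)).div hdc hdne
  have hc₂c : Continuous c₂ := (Complex.continuous_conj.comp (hev.comp hv₂c)).div hdc hdne
  refine ⟨u, fun z => c₁ z • v₁ z + c₂ z • v₂ z, huc, (hc₁c.smul hv₁c).add (hc₂c.smul hv₂c),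
    fun z => ?_⟩
  obtain ⟨hu0, β, hβ, hβ0⟩ := hu z
  obtain ⟨-, β₁, hβ₁, hβ₁0, -⟩ := hv₁ z
  obtain ⟨-, β₂, hβ₂, hβ₂0, -⟩ := hv₂ z
  have hone : c₁ z * v₁ z 0 + c₂ z * v₂ z 0 = 1 := by
    rw [hc₁, hc₂]
    have h1 := hdne z
    simp only [div_mul_eq_mul_div, ← Complex.normSq_eq_conj_mul_self, ← add_div]
    rw [div_eq_one_iff_eq h1, hd]
    push_cast
    rfl
  have hval : (c₁ z • v₁ z + c₂ z • v₂ z : C(Icc (0 : ℝ) 1, ℂ)) 0 = 1 := hone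
  have hext : (fun x => IccExtend zero_le_one (c₁ z • v₁ z + c₂ z • v₂ z : C(Icc (0 : ℝ) 1, ℂ)) x
      / γ x) = fun x => c₁ z * (IccExtend zero_le_one (v₁ z) x / γ x) +
        c₂ z * (IccExtend zero_le_one (v₂ z) x / γ x) := by
    ext x
    simp only [IccExtend_apply, ContinuousMap.add_apply, ContinuousMap.smul_apply, smul_eq_mul]
    ring
  have hsol : IsQuasiSolution p (fun x => q₀ x - z) (fun x => IccExtend zero_le_one
      (c₁ z • v₁ z + c₂ z • v₂ z : C(Icc (0 : ℝ) 1, ℂ)) x / γ x)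
      (fun x => c₁ z * β₁ x + c₂ z * β₂ x) := by
    rw [hext]
    exact (hβ₁.const_mul _).add (hβ₂.const_mul _)
  refine ⟨hu0, hval, β, _, hβ, hsol, fun x hx => ?_⟩
  rw [hwr z _ β _ hβ hβ0 hsol ?_ x hx, hval]
  rw [hval, ← hone, neg_add, ← mul_neg, ← mul_neg]
  exact (hβ₁0.const_mul _).add (hβ₂0.const_mul _)

end IsNonprincipalWeight

/-! ### Return to the equation `H f = z f` -/

namespace IsQuasiSolution

open SphericalSchrodinger

variable {l : ℝ} {q : ℝ → ℝ} {z : ℂ} {f β : ℝ → ℂ}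

/-- Expressing the derivative through `β` instead of `f'` makes it visibly locally absolutely
continuous, so it can be differentiated again almost everywhere. -/
theorem hasDerivAt_rpow_mul
    (h : IsQuasiSolution (fun x => x ^ (2 * l + 2)) (fun x => q x - z) f β)
    {x : ℝ} (hx : x ∈ Ioo (0 : ℝ) 1) :
    HasDerivAt (fun x => ((x ^ (l + 1) : ℝ) : ℂ) * f x)
      ((((l + 1) * x ^ l : ℝ) : ℂ) * f x + ((x ^ (-(l + 1)) : ℝ) : ℂ) * β x) x := by
  have h1 : HasDerivAt (fun x : ℝ => ((x ^ (l + 1) : ℝ) : ℂ)) (((l + 1) * x ^ l : ℝ) : ℂ) x := by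
    have := (Real.hasDerivAt_rpow_const (p := l + 1) (Or.inl hx.1.ne')).ofReal_comp
    simpa using this
  refine (h1.mul (h.hasDerivAt x hx)).congr_deriv ?_
  have h2 : (x ^ (2 * l + 2) : ℝ) = x ^ (l + 1) * x ^ (l + 1) := by
    rw [← Real.rpow_add hx.1]; congr 1; ring
  have h3 : ((x ^ (l + 1) : ℝ) : ℂ) ≠ 0 :=
    Complex.ofReal_ne_zero.2 (Real.rpow_pos_of_pos hx.1 _).ne'
  rw [h2, Real.rpow_neg hx.1.le]
  push_cast
  field_simp

theorem contDiffOn_ofReal_mul_rpow (c s : ℝ) :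
    ContDiffOn ℝ 1 (fun x : ℝ => ((c * x ^ s : ℝ) : ℂ)) (Ioo 0 1) := by
  refine Complex.ofRealCLM.contDiff.comp_contDiffOn (contDiffOn_const.mul ?_)
  exact contDiffOn_id.rpow_const_of_ne fun x hx => hx.1.ne'

/-- Solutions of `(x^(2l+2) f')' = x^(2l+2) (q - z) f` yield solutions `x^(l+1) f` of
`H g = z g`. -/
theorem isSolution (h : IsQuasiSolution (fun x => x ^ (2 * l + 2)) (fun x => q x - z) f β) :
    IsSolution l q z (fun x => ((x ^ (l + 1) : ℝ) : ℂ) * f x) where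
  differentiableAt x hx := (h.hasDerivAt_rpow_mul hx).differentiableAt
  deriv_absolutelyContinuous a b ha hab hb := by
    have hsub : uIcc a b ⊆ Ioo 0 1 := by
      rw [uIcc_of_le hab]
      exact fun x hx => ⟨ha.trans_le hx.1, hx.2.trans_lt hb⟩
    have hf : AbsolutelyContinuousOnInterval f a b := by
      refine ((h.contDiffOn ?_ fun x hx => Real.rpow_pos_of_pos hx.1 _).mono
        hsub).absolutelyContinuousOnInterval
      exact continuousOn_id.rpow_const fun x hx => Or.inl hx.1.ne'
    have h1 := (((contDiffOn_ofReal_mul_rpow (l + 1) l).mono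
      hsub).absolutelyContinuousOnInterval.fun_smul hf).fun_add
      (((contDiffOn_ofReal_mul_rpow 1 (-(l + 1))).mono
      hsub).absolutelyContinuousOnInterval.fun_smul (h.absolutelyContinuous a b ha hab hb))
    refine h1.congr fun x hx => ?_
    rw [(h.hasDerivAt_rpow_mul (hsub hx)).deriv]
    simp only [smul_eq_mul, one_mul]
  equation := by
    rw [ae_restrict_iff' measurableSet_Ioo]
    filter_upwards [h.ae_hasDerivAt] with x hx hx01
    have hpos := hx01.1
    have hd : ∀ᶠ y in 𝓝 x, deriv (fun x => ((x ^ (l + 1) : ℝ) : ℂ) * f x) y =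
        (((l + 1) * y ^ l : ℝ) : ℂ) * f y + ((y ^ (-(l + 1)) : ℝ) : ℂ) * β y := by
      filter_upwards [isOpen_Ioo.mem_nhds hx01] with y hy using (h.hasDerivAt_rpow_mul hy).deriv
    have h1 : HasDerivAt (fun x : ℝ => (((l + 1) * x ^ l : ℝ) : ℂ))
        (((l + 1) * (l * x ^ (l - 1)) : ℝ) : ℂ) x := by
      exact ((Real.hasDerivAt_rpow_const (p := l) (Or.inl hpos.ne')).const_mul (l + 1)).ofReal_comp
    have h2 : HasDerivAt (fun x : ℝ => ((x ^ (-(l + 1)) : ℝ) : ℂ))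
        ((-(l + 1) * x ^ (-(l + 1) - 1) : ℝ) : ℂ) x :=
      (Real.hasDerivAt_rpow_const (p := -(l + 1)) (Or.inl hpos.ne')).ofReal_comp
    have h3 := ((h1.mul (h.hasDerivAt x hx01)).add (h2.mul (hx hx01))).congr_of_eventuallyEq hd
    rw [H, h3.deriv]
    have hne : (x : ℂ) ≠ 0 := Complex.ofReal_ne_zero.2 hpos.ne'
    have e1 : x ^ (l + 1) = x ^ l * x := by rw [Real.rpow_add_one hpos.ne']
    have e2 : x ^ (l - 1) = x ^ l / x := by rw [Real.rpow_sub_one hpos.ne']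
    have e3 : x ^ (2 * l + 2) = (x ^ l * x) * (x ^ l * x) := by
      rw [← e1, ← Real.rpow_add hpos]; congr 1; ring
    have e4 : x ^ (-(l + 1)) = (x ^ l * x)⁻¹ := by rw [Real.rpow_neg hpos.le, e1]
    have e5 : x ^ (-(l + 1) - 1) = (x ^ l * x)⁻¹ / x := by rw [Real.rpow_sub_one hpos.ne', e4]
    have hne' : ((x ^ l : ℝ) : ℂ) ≠ 0 :=
      Complex.ofReal_ne_zero.2 (Real.rpow_pos_of_pos hpos _).ne'
    simp only [e1, e2, e3, e4, e5]
    push_cast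
    generalize ((x ^ l : ℝ) : ℂ) = X at hne' ⊢
    field_simp
    ring

/-- The terms from differentiating `x^(l+1)` cancel by antisymmetry, and `x^(l+1) x^(-(l+1)) = 1` in
the others. -/
theorem wronskian_rpow_mul {f₁ β₁ f₂ β₂ : ℝ → ℂ}
    (h₁ : IsQuasiSolution (fun x => x ^ (2 * l + 2)) (fun x => q x - z) f₁ β₁)
    (h₂ : IsQuasiSolution (fun x => x ^ (2 * l + 2)) (fun x => q x - z) f₂ β₂)
    {x : ℝ} (hx : x ∈ Ioo (0 : ℝ) 1) :
    W (fun x => ((x ^ (l + 1) : ℝ) : ℂ) * f₁ x) (fun x => ((x ^ (l + 1) : ℝ) : ℂ) * f₂ x) x =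
      f₁ x * β₂ x - β₁ x * f₂ x := by
  rw [W, (h₁.hasDerivAt_rpow_mul hx).deriv, (h₂.hasDerivAt_rpow_mul hx).deriv,
    Real.rpow_neg hx.1.le]
  have : ((x ^ (l + 1) : ℝ) : ℂ) ≠ 0 :=
    Complex.ofReal_ne_zero.2 (Real.rpow_pos_of_pos hx.1 _).ne'
  push_cast
  generalize ((x ^ (l + 1) : ℝ) : ℂ) = X at this ⊢
  field_simp
  ring

end IsQuasiSolution

/-! ### The two weights and their integrability -/

namespace SphericalSchrodinger

theorem linearIndependent_of_wronskian_eq_one {f g : ℝ → ℂ}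
    (hf : ∀ x ∈ Ioo (0 : ℝ) 1, DifferentiableAt ℝ f x)
    (hg : ∀ x ∈ Ioo (0 : ℝ) 1, DifferentiableAt ℝ g x)
    (hW : ∀ x ∈ Ioo (0 : ℝ) 1, W g f x = 1) :
    LinearIndependent ℂ ![(Ioo (0 : ℝ) 1).domRestrict f, (Ioo (0 : ℝ) 1).domRestrict g] := by
  rw [LinearIndependent.pair_iff]
  intro s t hst
  have h0 : ∀ x ∈ Ioo (0 : ℝ) 1, s * f x + t * g x = 0 := fun x hx => congrFun hst ⟨x, hx⟩
  have hm : (1 / 2 : ℝ) ∈ Ioo (0 : ℝ) 1 := by constructor <;> norm_num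
  have h1 : s * deriv f (1 / 2) + t * deriv g (1 / 2) = 0 := by
    refine (((hf _ hm).hasDerivAt.const_mul s).add
      ((hg _ hm).hasDerivAt.const_mul t)).unique ?_
    refine (hasDerivAt_const (1 / 2 : ℝ) (0 : ℂ)).congr_of_eventuallyEq ?_
    filter_upwards [isOpen_Ioo.mem_nhds hm] with x hx using h0 x hx
  have h2 := h0 _ hm
  have h3 := hW _ hm
  rw [W] at h3
  constructor
  · linear_combination (-s) * h3 + g (1 / 2) * h1 - deriv g (1 / 2) * h2
  · linear_combination (-t) * h3 - f (1 / 2) * h1 + deriv f (1 / 2) * h2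

/-- For `l > -1/2` the function `x^(-2l-1) / (2l+1)` is a non-principal solution. -/
theorem isNonprincipalWeight_rpow {l : ℝ} (hl : -1 / 2 < l) :
    IsNonprincipalWeight (fun x => x ^ (2 * l + 2)) (fun x => (2 * l + 1) * x ^ (2 * l + 1)) where
  continuousOn_coeff := continuousOn_id.rpow_const fun x hx => Or.inl hx.1.ne'
  coeff_pos x hx := Real.rpow_pos_of_pos hx.1 _
  continuousOn := continuousOn_const.mul
    (continuousOn_id.rpow_const fun x _ => Or.inr (by linarith))
  zero := by
    have : 2 * l + 1 ≠ 0 := by linarith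
    simp [Real.zero_rpow this]
  pos x hx := mul_pos (by linarith) (Real.rpow_pos_of_pos hx.1 _)
  monotoneOn x hx y hy hxy := mul_le_mul_of_nonneg_left
    (Real.rpow_le_rpow hx.1 hxy (by linarith)) (by linarith)
  hasDerivAt_inv x hx := by
    have ha : 2 * l + 1 ≠ 0 := by linarith
    have h1 := (Real.hasDerivAt_rpow_const (p := 2 * l + 1) (Or.inl hx.1.ne')).const_mul
      (2 * l + 1)
    have h2 := (Real.rpow_pos_of_pos hx.1 (2 * l + 1)).ne'
    refine (h1.inv (mul_ne_zero ha h2)).congr_deriv ?_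
    have e1 : x ^ (2 * l + 2) = x ^ (2 * l + 1) * x := by
      rw [← Real.rpow_add_one hx.1.ne']; congr 1; ring
    have hx0 := hx.1.ne'
    rw [Real.rpow_sub_one hx0, e1]
    generalize x ^ (2 * l + 1) = X at h2 ⊢
    generalize 2 * l + 1 = a at ha ⊢
    field_simp

/-- For `l = -1/2` the function `1 - log x` is a non-principal solution. -/
theorem isNonprincipalWeight_log :
    IsNonprincipalWeight (fun x => x ^ (2 * (-1 / 2 : ℝ) + 2))
      (fun x => if x = 0 then 0 else (1 - Real.log x)⁻¹) := by
  have e : (2 * (-1 / 2 : ℝ) + 2) = 1 := by norm_num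
  simp only [e, Real.rpow_one]
  have hlog : ∀ x ∈ Ioc (0 : ℝ) 1, 0 < 1 - Real.log x := fun x hx => by
    linarith [Real.log_nonpos hx.1.le hx.2]
  have hpos : ∀ x ∈ Ioc (0 : ℝ) 1, 0 < (if x = 0 then 0 else (1 - Real.log x)⁻¹) := fun x hx => by
    rw [if_neg hx.1.ne']
    exact inv_pos.2 (hlog x hx)
  refine ⟨continuousOn_id, fun x hx => hx.1, ?_, by simp, hpos, ?_, ?_⟩
  · intro x hx
    rcases hx.1.eq_or_lt with rfl | hx0
    · refine ContinuousAt.continuousWithinAt (continuousAt_iff_punctured_nhds.2 ?_)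
      rw [if_pos rfl]
      have h1 : Tendsto (fun x => 1 - Real.log x) (𝓝[≠] 0) atTop :=
        tendsto_atTop_add_const_left _ 1 (tendsto_neg_atBot_atTop.comp Real.tendsto_log_nhdsNE_zero)
      refine h1.inv_tendsto_atTop.congr' ?_
      filter_upwards [self_mem_nhdsWithin] with y hy
      rw [if_neg (show y ≠ 0 from hy)]
      rfl
    · refine ContinuousAt.continuousWithinAt ?_
      have h1 : ContinuousAt (fun x => (1 - Real.log x)⁻¹) x :=
        (continuousAt_const.sub (Real.continuousAt_log hx0.ne')).inv₀ (hlog x ⟨hx0, hx.2⟩).ne'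
      refine h1.congr ?_
      filter_upwards [eventually_ne_nhds hx0.ne'] with y hy
      rw [if_neg hy]
  · intro x hx y hy hxy
    rcases hx.1.eq_or_lt with rfl | hx0
    · rcases hy.1.eq_or_lt with rfl | hy0
      · exact le_rfl
      · simpa using (hpos y ⟨hy0, hy.2⟩).le
    · have hy0 := hx0.trans_le hxy
      simp only [if_neg hx0.ne', if_neg hy0.ne']
      exact inv_anti₀ (hlog y ⟨hy0, hy.2⟩) (by linarith [Real.log_le_log hx0 hxy])
  · intro x hx
    have h1 : HasDerivAt (fun x => 1 - Real.log x) (-x⁻¹) x :=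
      (Real.hasDerivAt_log hx.1.ne').const_sub 1
    refine h1.congr_of_eventuallyEq ?_
    filter_upwards [eventually_ne_nhds hx.1.ne'] with y hy
    rw [if_neg hy, inv_inv]

variable {l : ℝ} {q : ℝ → ℝ}

/-- Integrability of a multiple of `q` from its weighted integrability. -/
theorem IsAdmissible.intervalIntegrable_mul (hq : IsAdmissible l q) {m : ℝ → ℝ} {C : ℝ}
    (hm : ContinuousOn m (Ioo 0 1))
    (hC : ∀ x ∈ Ioo (0 : ℝ) 1, |m x| * |q x| ≤ C * (x * qTilde l q x)) :
    IntervalIntegrable (fun x => (m x : ℂ) * (q x : ℂ)) volume 0 1 := by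
  rw [intervalIntegrable_iff_integrableOn_Ioo_of_le zero_le_one]
  refine (hq.integrable.const_mul C).mono' ?_ ?_
  · exact ((Complex.continuous_ofReal.comp_continuousOn hm).aestronglyMeasurable
      measurableSet_Ioo).mul (Complex.continuous_ofReal.comp_aestronglyMeasurable hq.measurable)
  · filter_upwards [ae_restrict_mem measurableSet_Ioo] with x hx
    rw [norm_mul, Complex.norm_real, Complex.norm_real]
    exact hC x hx

theorem IsAdmissible.intervalIntegrable_weights_of_lt (hq : IsAdmissible l q) (hl : -1 / 2 < l) :
    IntervalIntegrable (fun y => ((y ^ (2 * l + 2) / ((2 * l + 1) * y ^ (2 * l + 1)) : ℝ) : ℂ) *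
      (q y : ℂ)) volume 0 1 ∧
    IntervalIntegrable (fun y => ((y ^ (2 * l + 2) / ((2 * l + 1) * y ^ (2 * l + 1)) : ℝ) : ℂ))
      volume 0 1 := by
  have ha : 0 < 2 * l + 1 := by linarith
  have heq : ∀ y ∈ Ioo (0 : ℝ) 1, y ^ (2 * l + 2) / ((2 * l + 1) * y ^ (2 * l + 1)) =
      (2 * l + 1)⁻¹ * y := by
    intro y hy
    have e1 : y ^ (2 * l + 2) = y ^ (2 * l + 1) * y := by
      rw [← Real.rpow_add_one hy.1.ne']; congr 1; ring
    have h2 := (Real.rpow_pos_of_pos hy.1 (2 * l + 1)).ne'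
    rw [e1]
    generalize y ^ (2 * l + 1) = X at h2 ⊢
    field_simp
  have hc : Continuous fun y : ℝ => (2 * l + 1)⁻¹ * y := by fun_prop
  constructor
  · refine hq.intervalIntegrable_mul (C := (2 * l + 1)⁻¹) (hc.continuousOn.congr heq) ?_
    intro x hx
    rw [heq x hx, qTilde, if_neg hl.ne', abs_of_pos (mul_pos (inv_pos.2 ha) hx.1), mul_assoc]
  · rw [intervalIntegrable_congr_uIoo (g := fun y => (((2 * l + 1)⁻¹ * y : ℝ) : ℂ))]
    · exact (Complex.continuous_ofReal.comp hc).intervalIntegrable _ _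
    · intro y hy
      rw [uIoo_of_le zero_le_one] at hy
      simp only [heq y hy]

/-- Here `p / γ = x (1 - log x)`, which is the source of the logarithm in `qTilde`. -/
theorem IsAdmissible.intervalIntegrable_weights_of_eq (hq : IsAdmissible (-1 / 2) q) :
    IntervalIntegrable (fun y => ((y ^ (2 * (-1 / 2 : ℝ) + 2) /
      (if y = 0 then 0 else (1 - Real.log y)⁻¹) : ℝ) : ℂ) * (q y : ℂ)) volume 0 1 ∧
    IntervalIntegrable (fun y => ((y ^ (2 * (-1 / 2 : ℝ) + 2) /
      (if y = 0 then 0 else (1 - Real.log y)⁻¹) : ℝ) : ℂ)) volume 0 1 := by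
  have e : (2 * (-1 / 2 : ℝ) + 2) = 1 := by norm_num
  simp only [e, Real.rpow_one]
  have heq : ∀ y ∈ Ioo (0 : ℝ) 1, y / (if y = 0 then 0 else (1 - Real.log y)⁻¹) =
      y - y * Real.log y := by
    intro y hy
    rw [if_neg hy.1.ne', div_inv_eq_mul]
    ring
  have hc : Continuous fun y : ℝ => y - y * Real.log y :=
    continuous_id.sub Real.continuous_mul_log
  constructor
  · refine hq.intervalIntegrable_mul (C := 1) (hc.continuousOn.congr heq) ?_
    intro x hx
    have h1 : 0 ≤ x - x * Real.log x := by
      nlinarith [hx.1, Real.log_nonpos hx.1.le hx.2.le]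
    rw [heq x hx, qTilde, if_pos rfl, abs_of_nonneg h1]
    apply le_of_eq
    ring
  · rw [intervalIntegrable_congr_uIoo (g := fun y => ((y - y * Real.log y : ℝ) : ℂ))]
    · exact (Complex.continuous_ofReal.comp hc).intervalIntegrable _ _
    · intro y hy
      rw [uIoo_of_le zero_le_one] at hy
      simp only [heq y hy]

/-- The convention `Real.log 0 = 0` gives `(Real.log 0)⁻¹ = 0`, which is the true limit at `0`. -/
theorem continuousOn_inv_log : ContinuousOn (fun x => (Real.log x)⁻¹) (Ico 0 1) := by
  intro x hx
  rcases hx.1.eq_or_lt with rfl | hx0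
  · refine ContinuousAt.continuousWithinAt (continuousAt_iff_punctured_nhds.2 ?_)
    simpa using! Real.tendsto_log_nhdsNE_zero.inv_tendsto_atBot
  · exact ((Real.continuousAt_log hx0.ne').inv₀
      (Real.log_neg hx0 hx.2).ne).continuousWithinAt

theorem continuous_uncurry_IccExtend {u : ℂ → C(Icc (0 : ℝ) 1, ℂ)} (hu : Continuous u) :
    Continuous (Function.uncurry fun z x => IccExtend zero_le_one (u z) x) :=
  (hu.comp continuous_fst).eval (continuous_projIcc.comp continuous_snd)

/-- The solutions `φ = x^(l+1) u` and `θ = x^(l+1) v / γ`. -/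
theorem exists_solutions {γ : ℝ → ℝ}
    (hγ : IsNonprincipalWeight (fun x => x ^ (2 * l + 2)) γ)
    (hw₀ : IntervalIntegrable (fun y => ((y ^ (2 * l + 2) / γ y : ℝ) : ℂ) * (q y : ℂ)) volume 0 1)
    (hw₁ : IntervalIntegrable (fun y => ((y ^ (2 * l + 2) / γ y : ℝ) : ℂ)) volume 0 1) :
    ∃ u v : ℂ → ℝ → ℂ, Continuous (Function.uncurry u) ∧ Continuous (Function.uncurry v) ∧
      ∀ z, u z 0 = 1 ∧ v z 0 = 1 ∧
      IsSolution l q z (fun x => ((x ^ (l + 1) : ℝ) : ℂ) * u z x) ∧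
      IsSolution l q z (fun x => ((x ^ (l + 1) : ℝ) : ℂ) * (v z x / γ x)) ∧
      LinearIndependent ℂ
        ![(Ioo (0 : ℝ) 1).domRestrict (fun x => ((x ^ (l + 1) : ℝ) : ℂ) * u z x),
          (Ioo (0 : ℝ) 1).domRestrict (fun x => ((x ^ (l + 1) : ℝ) : ℂ) * (v z x / γ x))] ∧
      ∀ x ∈ Ioo (0 : ℝ) 1, W (fun x => ((x ^ (l + 1) : ℝ) : ℂ) * (v z x / γ x))
        (fun x => ((x ^ (l + 1) : ℝ) : ℂ) * u z x) x = 1 := by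
  obtain ⟨u, v, hu, hv, h⟩ := hγ.exists_solution_pair hw₀ hw₁
  refine ⟨_, _, continuous_uncurry_IccExtend hu, continuous_uncurry_IccExtend hv, fun z => ?_⟩
  obtain ⟨hu0, hv0, β, β', h1, h2, h3⟩ := h z
  have h0 : ∀ f : C(Icc (0 : ℝ) 1, ℂ), IccExtend zero_le_one f 0 = f 0 := fun f =>
    IccExtend_of_mem _ _ (left_mem_Icc.2 zero_le_one)
  have hW : ∀ x ∈ Ioo (0 : ℝ) 1, W
      (fun x => ((x ^ (l + 1) : ℝ) : ℂ) * (IccExtend zero_le_one (v z) x / γ x))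
      (fun x => ((x ^ (l + 1) : ℝ) : ℂ) * IccExtend zero_le_one (u z) x) x = 1 := fun x hx => by
    rw [h2.wronskian_rpow_mul h1 hx, h3 x hx]
  exact ⟨(h0 _).trans hu0, (h0 _).trans hv0, h1.isSolution, h2.isSolution,
    linearIndependent_of_wronskian_eq_one h1.isSolution.differentiableAt
      h2.isSolution.differentiableAt hW, hW⟩

end SphericalSchrodinger

/-! ### Assembly of the two cases -/

theorem mainTheorem8 (l : ℝ) (q : ℝ → ℝ) (hq : SphericalSchrodinger.IsAdmissible l q) :
    ∃ φ θ φt θt : ℂ → ℝ → ℂ,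
      -- for every `z`, two linearly independent solutions on `(0, 1)` with Wronskian `1`
      (∀ z : ℂ, SphericalSchrodinger.IsSolution l q z (φ z) ∧
        SphericalSchrodinger.IsSolution l q z (θ z) ∧
        LinearIndependent ℂ ![(Ioo (0 : ℝ) 1).domRestrict (φ z), (Ioo (0 : ℝ) 1).domRestrict (θ z)] ∧
        ∀ x ∈ Ioo (0 : ℝ) 1, SphericalSchrodinger.W (θ z) (φ z) x = 1) ∧
      -- the form of `φ`
      (∀ z : ℂ, ∀ x ∈ Ioo (0 : ℝ) 1, φ z x = ((x ^ (l + 1) : ℝ) : ℂ) * φt z x) ∧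
      ContinuousOn (Function.uncurry φt) (univ ×ˢ Icc (0 : ℝ) 1) ∧
      -- the form of `θ` for `l > -1/2`
      (-1 / 2 < l →
        (∀ z : ℂ, ∀ x ∈ Ioo (0 : ℝ) 1,
          θ z x = ((x ^ (-l) / (2 * l + 1) : ℝ) : ℂ) * θt z x) ∧
        ContinuousOn (Function.uncurry θt) (univ ×ˢ Icc (0 : ℝ) 1)) ∧
      -- the form of `θ` for `l = -1/2`; as `log 1 = 0`, continuity at `x = 1` concerns `θ` itself
      (l = -1 / 2 →
        (∀ z : ℂ, ∀ x ∈ Ioo (0 : ℝ) 1,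
          θ z x = ((-(x ^ (1 / 2 : ℝ) * Real.log x) : ℝ) : ℂ) * θt z x) ∧
        ContinuousOn (Function.uncurry θt) (univ ×ˢ Ico (0 : ℝ) 1) ∧
        ContinuousOn (Function.uncurry θ) (univ ×ˢ Ioc (0 : ℝ) 1)) ∧
      -- the values at `x = 0`
      (∀ z : ℂ, φt z 0 = (θt z 0)⁻¹ ∧ φt z 0 ≠ 0) := by
  rcases hq.neg_half_le.lt_or_eq with hl | hl
  · obtain ⟨hw₀, hw₁⟩ := hq.intervalIntegrable_weights_of_lt hl
    obtain ⟨u, v, hu, hv, h⟩ :=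
      SphericalSchrodinger.exists_solutions (SphericalSchrodinger.isNonprincipalWeight_rpow hl)
        hw₀ hw₁
    refine ⟨fun z x => ((x ^ (l + 1) : ℝ) : ℂ) * u z x, fun z x => ((x ^ (l + 1) : ℝ) : ℂ) *
      (v z x / ((2 * l + 1) * x ^ (2 * l + 1) : ℝ)), u, v, fun z => (h z).2.2, fun z x hx => rfl,
      hu.continuousOn, fun _ => ⟨fun z x hx => ?_, hv.continuousOn⟩, fun h' => absurd h' hl.ne',
      fun z => ?_⟩
    · have ha : ((2 * l + 1 : ℝ) : ℂ) ≠ 0 := Complex.ofReal_ne_zero.2 (by linarith)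
      have e1 : x ^ (2 * l + 1) = x ^ (l + 1) * x ^ l := by
        rw [← Real.rpow_add hx.1]; congr 1; ring
      have h1 : ((x ^ (l + 1) : ℝ) : ℂ) ≠ 0 :=
        Complex.ofReal_ne_zero.2 (Real.rpow_pos_of_pos hx.1 _).ne'
      have h2 : ((x ^ l : ℝ) : ℂ) ≠ 0 :=
        Complex.ofReal_ne_zero.2 (Real.rpow_pos_of_pos hx.1 _).ne'
      simp only [e1, Real.rpow_neg hx.1.le, Complex.ofReal_mul, Complex.ofReal_mul, Complex.ofReal_div,
        Complex.ofReal_inv]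
      field_simp
    · rw [(h z).1, (h z).2.1]
      simp
  · subst hl
    obtain ⟨hw₀, hw₁⟩ := hq.intervalIntegrable_weights_of_eq
    have hγ := SphericalSchrodinger.isNonprincipalWeight_log
    obtain ⟨u, v, hu, hv, h⟩ := SphericalSchrodinger.exists_solutions hγ hw₀ hw₁
    -- The extra factor comes from `1 - log x = -log x (1 - 1 / log x)`. It equals `1` at `x = 0`,
    -- so the normalization there is kept, and it is singular at `x = 1`.
    refine ⟨_, _, u, fun z x => v z x * ((1 - (Real.log x)⁻¹ : ℝ) : ℂ), fun z => (h z).2.2,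
      fun z x hx => rfl, hu.continuousOn, fun h' => absurd h' (lt_irrefl _),
      fun _ => ⟨fun z x hx => ?_, ?_, ?_⟩, fun z => ?_⟩
    · have hlog : (Real.log x : ℂ) ≠ 0 := Complex.ofReal_ne_zero.2 (Real.log_neg hx.1 hx.2).ne
      have e1 : (-1 / 2 + 1 : ℝ) = 1 / 2 := by norm_num
      simp only [if_neg hx.1.ne', e1]
      push_cast
      rw [div_inv_eq_mul]
      field_simp
      ring
    · refine hv.continuousOn.mul (Complex.continuous_ofReal.comp_continuousOn
        (continuousOn_const.sub ?_))
      exact SphericalSchrodinger.continuousOn_inv_log.comp continuousOn_snd fun y hy => hy.2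
    -- Continuity of `θ` at `x = 1` is read off from `x^(1/2) v / γ`, where `γ` does not vanish on
    -- `(0, 1]`.
    · have hγc : ContinuousOn (fun x : ℝ => if x = 0 then 0 else (1 - Real.log x)⁻¹) (Ioc 0 1) :=
        hγ.continuousOn.mono Ioc_subset_Icc_self
      have hp : ContinuousOn (fun x : ℝ => x ^ (-1 / 2 + 1 : ℝ)) (Ioc 0 1) :=
        continuousOn_id.rpow_const fun x hx => Or.inl hx.1.ne'
      refine (Complex.continuous_ofReal.comp_continuousOn
        (hp.comp continuousOn_snd fun y hy => hy.2)).mul (hv.continuousOn.div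
        (Complex.continuous_ofReal.comp_continuousOn
        (hγc.comp continuousOn_snd fun y hy => hy.2)) fun y hy => ?_)
      exact Complex.ofReal_ne_zero.2 (hγ.pos _ hy.2).ne'
    · simp only [(h z).1, (h z).2.1]
      simp
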